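/- Let $L\ge 3$, $0<\lambda<1$ and $\gamma_p,\theta_p,\theta_s,\sigma^2>0$. Let $g_p\sim\exp(1)$, let $h_x\in\mathbb C^L$ have i.i.d. $\mathcal{CN}(0,\lambda)$ entries and $h_s\in\mathbb C^L$ i.i.d. $\mathcal{CN}(0,1)$ entries, and put $g_x=\|h_x\|^2/\lambda$, $s_x=h_x/\|h_x\|$, $g_s=\|h_s\|^2$, $s_s=h_s/\|h_s\|$. Let the unit vector $\hat s_x=Q(s_x,U)$ be the output of a $B$-bit (possibly randomized) quantizer of $s_x$, where $g_p,h_x,h_s,U$ are independent and the quantization error $\epsilon=1-|\hat s_x^\dagger s_x|^2$ satisfies $\Pr(\epsilon\le\tau)=2^B\tau^{L-1}$ for $0\le\tau\le 2^{-B/(L-1)}$ and $\Pr(\epsilon\le\tau)=1$ for larger $\tau$. Let $\omega=\sigma^2(\gamma_pg_p/\theta_p-1)$, and let the secondary-user (SU) power budget be $P_s=\min\{\omega/(\lambda g_x\epsilon),P_{\max}\}$ if $\omega\ge0$ and $P_s=P_{\max}$ if $\omega<0$ (perfect interference-power-control feedback, no feedforward). The orthogonal cognitive beamformer $f$ maximizes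 $|f^\dagger s_s|^2$ subject to $f^\dagger\hat s_x=0$ and $\|f\|^2\le P_s$, and the SU outage probability is $$P_{\rm out}=\Pr\Bigl(\tfrac{g_s}{\sigma^2}|f^\dagger s_s|^2\le\theta_s\Bigr).$$ Then for every integer $B\ge0$ the limit $P_\infty(B)=\lim_{P_{\max}\to\infty}P_{\rm out}$ exists and depends only on $L,\lambda,\gamma_p,\theta_p,\theta_s,B$. As $B\to\infty$ with the other parameters fixed, if $L\ge4$, $$P_\infty(B)=e^{-\theta_p/\gamma_p}\,\frac{(L-1)\lambda\theta_p\theta_s}{(L-2)\gamma_p}\,2^{-\frac{B}{L-1}}+O\bigl(2^{-\frac{2B}{L-1}}\bigr),$$ and if $L=3$ the same expansion holds with the error term $O\bigl(B\,2^{-\frac{2B}{L-1}}\bigr)$. Moreover, for every $L\ge3$ there is a function $R(B)=O\bigl(2^{-\frac{2B}{L-1}}\bigr)$ with $$P_\infty(B)>e^{-\theta_p/\gamma_p}\,\frac{\lambda\theta_p\theta_s}{\gamma_p}\,2^{-\frac{B}{L-1}}+R(B)\quad\text{for all }B\ge0,$$ and for all sufficiently large $B$ this inequality holds with $R(B)=0$.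 -/

import Mathlib

open MeasureTheory ProbabilityTheory Filter Topology Asymptotics

namespace CognitiveBeamforming

/-- The law `CN(0, v)` of a circularly symmetric complex Gaussian variable with mean zero and
variance `v`: real and imaginary parts are independent real Gaussians of variance `v / 2`. -/
noncomputable def complexGaussian (v : ℝ) : Measure ℂ :=
  ((gaussianReal 0 (v / 2).toNNReal).prod (gaussianReal 0 (v / 2).toNNReal)).map
    (fun p : ℝ × ℝ => (⟨p.1, p.2⟩ : ℂ))

/-- The law of an `L × 1` vector with i.i.d. `CN(0, v)` entries. -/
noncomputable def complexGaussianVec (L : ℕ) (v : ℝ) : Measure (EuclideanSpace ℂ (Fin L)) :=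
  (Measure.pi (fun _ : Fin L => complexGaussian v)).map (WithLp.toLp 2)

/-- The channel shape `h / ‖h‖` of a channel vector `h`. -/
noncomputable def shape {L : ℕ} (h : EuclideanSpace ℂ (Fin L)) : EuclideanSpace ℂ (Fin L) :=
  ((‖h‖⁻¹ : ℝ) : ℂ) • h

/-- The quantization error `ε = 1 - |ŝ† s|²`; `inner ℂ a b` is `a† b`. -/
noncomputable def quantError {L : ℕ} (sHat s : EuclideanSpace ℂ (Fin L)) : ℝ :=
  1 - ‖inner ℂ sHat s‖ ^ 2

/-- The random variables of the system on a probability space `(Ω, μ)`: primary channel power `gp`,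
interference channel `hx` (SU transmitter to PU receiver), secondary channel `hs`, and the
quantizer of the shape of `hx` with `B` feedback bits. The quantizer `Q` may use additional
randomness `U`, so that the quantized shape is `Q (shape hx) U`; `gp`, `hx`, `hs`, `U` are
mutually independent. -/
structure SystemModel {Ω 𝒰 : Type*} [MeasurableSpace Ω] [MeasurableSpace 𝒰]
    (μ : Measure Ω) (L : ℕ) (lam : ℝ) (B : ℕ) where
  gp : Ω → ℝ
  hx : Ω → EuclideanSpace ℂ (Fin L)
  hs : Ω → EuclideanSpace ℂ (Fin L)
  U : Ω → 𝒰
  Q : EuclideanSpace ℂ (Fin L) → 𝒰 → EuclideanSpace ℂ (Fin L)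
  measurable_gp : Measurable gp
  measurable_hx : Measurable hx
  measurable_hs : Measurable hs
  measurable_U : Measurable U
  measurable_Q : Measurable (Function.uncurry Q)
  law_gp : μ.map gp = expMeasure 1
  law_hx : μ.map hx = complexGaussianVec L lam
  law_hs : μ.map hs = complexGaussianVec L 1
  indep_gp : IndepFun gp (fun ω => (hx ω, hs ω, U ω)) μ
  indep_hx : IndepFun hx (fun ω => (hs ω, U ω)) μ
  indep_hs : IndepFun hs U μ
  norm_Q : ∀ s u, ‖s‖ = 1 → ‖Q s u‖ = 1
  /-- The cumulative distribution function of the quantization error. -/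
  quantError_cdf : ∀ τ : ℝ, 0 ≤ τ → τ ≤ (2 : ℝ) ^ (-(B : ℝ) / ((L : ℝ) - 1)) →
    μ.real {ω | quantError (Q (shape (hx ω)) (U ω)) (shape (hx ω)) ≤ τ} = 2 ^ B * τ ^ (L - 1)
  quantError_cdf_one : ∀ τ : ℝ, (2 : ℝ) ^ (-(B : ℝ) / ((L : ℝ) - 1)) ≤ τ →
    μ.real {ω | quantError (Q (shape (hx ω)) (U ω)) (shape (hx ω)) ≤ τ} = 1

/-- The interference margin `σ² (γ_p g_p / θ_p - 1)` at the PU receiver. -/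
noncomputable def interferenceMargin (σ2 γp θp gp : ℝ) : ℝ := σ2 * (γp * gp / θp - 1)

/-- The unquantized interference-power-control signal `η` without feedforward, as a function of
the margin `w`, the interference channel gain `gx` and the quantization error `ε`. -/
noncomputable def ipcSignal (lam Pmax w gx ε : ℝ) : ℝ :=
  if 0 ≤ w then w / (lam * gx * ε) else Pmax

/-- The SU power budget when the signal `η` is fed back perfectly. -/
noncomputable def powerBudget (lam Pmax w gx ε : ℝ) : ℝ :=
  if 0 ≤ w ∧ ipcSignal lam Pmax w gx ε < Pmax then ipcSignal lam Pmax w gx ε else Pmax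

/-- `f` is an orthogonal cognitive beamformer: it maximizes `|f† s|²` subject to `f† ŝ = 0` and
`‖f‖² ≤ P`. -/
def IsOCB {L : ℕ} (sHat s : EuclideanSpace ℂ (Fin L)) (P : ℝ)
    (f : EuclideanSpace ℂ (Fin L)) : Prop :=
  f ∈ {v : EuclideanSpace ℂ (Fin L) | inner ℂ v sHat = 0 ∧ ‖v‖ ^ 2 ≤ P} ∧
  IsMaxOn (fun v : EuclideanSpace ℂ (Fin L) => ‖inner ℂ v s‖ ^ 2)
    {v : EuclideanSpace ℂ (Fin L) | inner ℂ v sHat = 0 ∧ ‖v‖ ^ 2 ≤ P} f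

namespace SystemModel

variable {Ω 𝒰 : Type*} [MeasurableSpace Ω] [MeasurableSpace 𝒰]
  {μ : Measure Ω} {L : ℕ} {lam : ℝ} {B : ℕ}

/-- The quantized interference channel shape `ŝ_x`. -/
noncomputable def sxHat (M : SystemModel (𝒰 := 𝒰) μ L lam B) (ω : Ω) : EuclideanSpace ℂ (Fin L) :=
  M.Q (shape (M.hx ω)) (M.U ω)

/-- The interference channel gain `g_x = ‖h_x‖² / λ`. -/
noncomputable def gx (M : SystemModel (𝒰 := 𝒰) μ L lam B) (ω : Ω) : ℝ := ‖M.hx ω‖ ^ 2 / lam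

/-- The SU power budget: quantized CDI, perfect IPC feedback, no feedforward. -/
noncomputable def suPower (M : SystemModel (𝒰 := 𝒰) μ L lam B) (σ2 γp θp Pmax : ℝ) (ω : Ω) : ℝ :=
  powerBudget lam Pmax (interferenceMargin σ2 γp θp (M.gp ω)) (M.gx ω)
    (quantError (M.sxHat ω) (shape (M.hx ω)))

/-- For the maximal power `Pmax`, the random beamformer `f` is almost surely an orthogonal
cognitive beamformer under the above power budget. -/
def IsBeamformer (M : SystemModel (𝒰 := 𝒰) μ L lam B) (σ2 γp θp Pmax : ℝ)
    (f : Ω → EuclideanSpace ℂ (Fin L)) : Prop :=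
  ∀ᵐ ω ∂μ, IsOCB (M.sxHat ω) (shape (M.hs ω)) (M.suPower σ2 γp θp Pmax ω) (f ω)

/-- The receive SNR `(g_s / σ²) |f† s_s|²` at the SU receiver, with `g_s = ‖h_s‖²`. -/
noncomputable def snr (M : SystemModel (𝒰 := 𝒰) μ L lam B) (σ2 : ℝ)
    (f : Ω → EuclideanSpace ℂ (Fin L)) (ω : Ω) : ℝ :=
  ‖M.hs ω‖ ^ 2 / σ2 * ‖inner ℂ (f ω) (shape (M.hs ω))‖ ^ 2

/-- The SU outage probability `Pr(SNR_s ≤ θ_s)`. -/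
noncomputable def outage (M : SystemModel (𝒰 := 𝒰) μ L lam B) (σ2 θs : ℝ)
    (f : Ω → EuclideanSpace ℂ (Fin L)) : ℝ :=
  μ.real {ω | M.snr σ2 f ω ≤ θs}

end SystemModel

end CognitiveBeamforming

/-!
Write `n = L - 1` and `δ = 2 ^ (-B / n)`. Conditionally on the quantized direction, the squared norm
of the part of `h_s` orthogonal to it is `Gamma(n)`. The error `ε / δ` is `Beta(n, 1)` and
`‖h_x‖² / λ` is `Gamma(n + 1)`, so by the beta–gamma identity `‖h_x‖² ε / (λ δ)` is again
`Gamma(n)`. Conditioning on the two gamma variables, as `Pmax → ∞` the outage probability tends to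
`e ^ (-θp / γp) * E[1 - (1 + t / G) ^ (-n)]` with `G ∼ Gamma(n)` and `t = λ θp θs δ / γp`.

The linear term of `1 - (1 + t / G) ^ (-n)` has mean `n t / (n - 1)`, and Bernoulli's inequality
bounds the remainder by a multiple of `t² E[1 / (G (G + t))]`. This expectation stays bounded for
`n ≥ 3` and grows like `log (1 / t)` for `n = 2`. For the outage floor, `G + t ≥ 2 √(G t)` gives a
remainder of order `t ^ (3 / 2)` in both cases, which is absorbed by the excess of `n / (n - 1)`
over `1` and an error of order `t²`.
-/

namespace CognitiveBeamforming

section GammaBeta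

variable {a r : ℝ}

theorem integral_gammaMeasure (ha : 0 < a) (hr : 0 < r) {E : Type*} [NormedAddCommGroup E]
    [NormedSpace ℝ E] (f : ℝ → E) :
    ∫ x, f x ∂(gammaMeasure a r) =
      (r ^ a / Real.Gamma a) • ∫ x in Set.Ioi 0, (x ^ (a - 1) * Real.exp (-(r * x))) • f x := by
  have hm : Measurable (gammaPDF a r) := (measurable_gammaPDFReal a r).ennreal_ofReal
  have hpdf (x : ℝ) : (gammaPDF a r x).toReal • f x =
      (Set.Ici 0).indicator (fun x : ℝ => (r ^ a / Real.Gamma a) •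
        ((x ^ (a - 1) * Real.exp (-(r * x))) • f x)) x := by
    rw [gammaPDF, ENNReal.toReal_ofReal (gammaPDFReal_nonneg ha hr x), gammaPDFReal]
    split_ifs with hx
    · rw [Set.indicator_of_mem (Set.mem_Ici.mpr hx), smul_smul, mul_assoc]
    · rw [Set.indicator_of_notMem (by simpa using hx), zero_smul]
  rw [gammaMeasure, integral_withDensity_eq_integral_toReal_smul hm (by simp [gammaPDF])]
  simp_rw [hpdf]
  rw [integral_indicator measurableSet_Ici, integral_Ici_eq_integral_Ioi, integral_smul]

theorem mgf_id_gammaMeasure (ha : 0 < a) (hr : 0 < r) {t : ℝ} (ht : t < r) :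
    mgf id (gammaMeasure a r) t = r ^ a * (r - t) ^ (-a) := by
  have hrt : 0 < r - t := sub_pos.mpr ht
  have hmul (x : ℝ) : (x ^ (a - 1) * Real.exp (-(r * x))) • Real.exp (t * x) =
      x ^ (a - 1) * Real.exp (-((r - t) * x)) := by
    rw [smul_eq_mul, mul_assoc, ← Real.exp_add]
    ring_nf
  simp_rw [mgf, id_eq]
  rw [integral_gammaMeasure ha hr]
  simp_rw [hmul]
  rw [Real.integral_rpow_mul_exp_neg_mul_Ioi ha hrt, smul_eq_mul, one_div,
    Real.inv_rpow hrt.le, ← Real.rpow_neg hrt.le]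
  have := Real.Gamma_pos_of_pos ha
  field_simp

theorem Iio_subset_integrableExpSet_gammaMeasure (ha : 0 < a) (hr : 0 < r) :
    Set.Iio r ⊆ integrableExpSet id (gammaMeasure a r) := by
  intro t ht
  refine Integrable.of_integral_ne_zero (f := fun x => Real.exp (t * id x)) ?_
  have := mgf_id_gammaMeasure ha hr ht
  rw [mgf] at this
  rw [this]
  have := Real.rpow_pos_of_pos (sub_pos.mpr ht) (-a)
  positivity

theorem complexMGF_id_gammaMeasure (ha : 0 < a) (hr : 0 < r) {z : ℂ} (hz : z.re < r) :
    complexMGF id (gammaMeasure a r) z = (r : ℂ) ^ (a : ℂ) * (r - z) ^ (-a : ℂ) := by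
  have hre {w : ℂ} (hw : w.re < r) : (r - w) ∈ Complex.slitPlane :=
    Or.inl (by simpa using hw)
  have hleft : AnalyticOnNhd ℂ (complexMGF id (gammaMeasure a r)) {w | w.re < r} :=
    analyticOnNhd_complexMGF.mono fun w hw =>
      interior_mono (Iio_subset_integrableExpSet_gammaMeasure ha hr) (by simpa using hw)
  have hright : AnalyticOnNhd ℂ (fun w => (r : ℂ) ^ (a : ℂ) * (r - w) ^ (-a : ℂ))
      {w | w.re < r} := fun w hw =>
    analyticAt_const.mul ((analyticAt_const.sub analyticAt_id).cpow analyticAt_const (hre hw))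
  have hreal : ∀ᶠ t : ℝ in 𝓝[≠] 0, complexMGF id (gammaMeasure a r) t =
      (r : ℂ) ^ (a : ℂ) * (r - t) ^ (-a : ℂ) := by
    filter_upwards [mem_nhdsWithin_of_mem_nhds (Iio_mem_nhds hr)] with t ht
    rw [complexMGF_ofReal, mgf_id_gammaMeasure ha hr ht, Complex.ofReal_mul,
      Complex.ofReal_cpow hr.le, Complex.ofReal_cpow (sub_nonneg.mpr (Set.mem_Iio.mp ht).le)]
    push_cast
    rfl
  have hofReal : Tendsto ((↑) : ℝ → ℂ) (𝓝[≠] 0) (𝓝[≠] 0) := by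
    refine tendsto_nhdsWithin_of_tendsto_nhds_of_eventually_within _
      ((Complex.continuous_ofReal.tendsto' 0 0 Complex.ofReal_zero).mono_left
        nhdsWithin_le_nhds) ?_
    filter_upwards [self_mem_nhdsWithin] with t ht using by simpa using ht
  -- Both sides are analytic on the half-plane, so agreement on its real points suffices.
  exact hleft.eqOn_of_preconnected_of_frequently_eq hright
    (convex_halfSpace_re_lt r).isPreconnected (by simpa using hr)
    (hofReal.frequently hreal.frequently) hz

theorem charFun_gammaMeasure (ha : 0 < a) (hr : 0 < r) (t : ℝ) :
    charFun (gammaMeasure a r) t = (r : ℂ) ^ (a : ℂ) * (r - t * Complex.I) ^ (-a : ℂ) := by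
  rw [← complexMGF_id_mul_I, complexMGF_id_gammaMeasure ha hr (by simpa using hr)]

theorem integral_rpow_gammaMeasure (ha : 0 < a) (hr : 0 < r) {s : ℝ} (has : 0 < a + s) :
    ∫ x, x ^ s ∂(gammaMeasure a r) = Real.Gamma (a + s) / (Real.Gamma a * r ^ s) := by
  have hmul : ∀ x ∈ Set.Ioi (0 : ℝ), (x ^ (a - 1) * Real.exp (-(r * x))) • x ^ s =
      x ^ (a + s - 1) * Real.exp (-(r * x)) := by
    intro x hx
    rw [smul_eq_mul, mul_right_comm, ← Real.rpow_add hx]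
    ring_nf
  rw [integral_gammaMeasure ha hr, setIntegral_congr_fun measurableSet_Ioi hmul,
    Real.integral_rpow_mul_exp_neg_mul_Ioi has hr, smul_eq_mul, one_div, Real.inv_rpow hr.le,
    Real.rpow_add hr]
  have := Real.rpow_pos_of_pos hr a
  have := Real.rpow_pos_of_pos hr s
  have := Real.Gamma_pos_of_pos ha
  field_simp

theorem integrable_rpow_gammaMeasure (ha : 0 < a) (hr : 0 < r) {s : ℝ} (has : 0 < a + s) :
    Integrable (fun x => x ^ s) (gammaMeasure a r) := by
  refine Integrable.of_integral_ne_zero ?_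
  rw [integral_rpow_gammaMeasure ha hr has]
  have := Real.rpow_pos_of_pos hr s
  have := Real.Gamma_pos_of_pos ha
  have := Real.Gamma_pos_of_pos has
  positivity

theorem ae_pos_gammaMeasure (a r : ℝ) : ∀ᵐ x ∂(gammaMeasure a r), 0 < x := by
  have hm : Measurable (gammaPDF a r) := (measurable_gammaPDFReal a r).ennreal_ofReal
  rw [gammaMeasure, ae_withDensity_iff hm]
  filter_upwards [Measure.ae_ne volume 0] with x hx0 hpdf
  by_contra! hx
  exact hpdf (gammaPDF_of_neg (hx.lt_of_ne hx0))

theorem betaPDFReal_one_right (ha : 0 < a) (x : ℝ) :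
    betaPDFReal a 1 x = (Set.Ioo 0 1).indicator (fun x => a * x ^ (a - 1)) x := by
  have hbeta : 1 / beta a 1 = a := by
    have := Real.Gamma_pos_of_pos ha
    rw [beta, Real.Gamma_one, Real.Gamma_add_one ha.ne']
    field_simp
  simp [betaPDFReal, Set.indicator, hbeta]

theorem integral_betaMeasure_one_right (ha : 0 < a) {E : Type*} [NormedAddCommGroup E]
    [NormedSpace ℝ E] (f : ℝ → E) :
    ∫ x, f x ∂(betaMeasure a 1) = ∫ x in (0 : ℝ)..1, (a * x ^ (a - 1)) • f x := by
  have hm : Measurable (betaPDF a 1) := (measurable_betaPDFReal a 1).ennreal_ofReal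
  have hpdf (x : ℝ) : (betaPDF a 1 x).toReal • f x =
      (Set.Ioo 0 1).indicator (fun x => (a * x ^ (a - 1)) • f x) x := by
    rw [betaPDF, betaPDFReal_one_right ha, ENNReal.toReal_ofReal, ← Set.indicator_smul_apply_left]
    exact Set.indicator_nonneg (fun x hx => by have := hx.1; positivity) x
  rw [betaMeasure, integral_withDensity_eq_integral_toReal_smul hm (by simp [betaPDF]),
    intervalIntegral.integral_of_le zero_le_one, integral_Ioc_eq_integral_Ioo,
    ← integral_indicator measurableSet_Ioo]
  simp_rw [hpdf]

theorem betaMeasure_one_right_real_Iic (ha : 0 < a) {x : ℝ} (hx0 : 0 ≤ x) (hx1 : x ≤ 1) :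
    (betaMeasure a 1).real (Set.Iic x) = x ^ a := by
  have hind (y : ℝ) : (a * y ^ (a - 1)) • (Set.Iic x).indicator 1 y =
      (Set.Iic x).indicator (fun y => a * y ^ (a - 1)) y := by simp [Set.indicator_apply]
  rw [← integral_indicator_one measurableSet_Iic, integral_betaMeasure_one_right ha,
    intervalIntegral.integral_of_le zero_le_one]
  simp_rw [hind]
  rw [setIntegral_indicator measurableSet_Iic, Set.Ioc_inter_Iic, min_eq_right hx1,
    ← intervalIntegral.integral_of_le hx0, intervalIntegral.integral_const_mul,
    integral_rpow (Or.inl (by linarith)), sub_add_cancel, Real.zero_rpow ha.ne', sub_zero,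
    mul_div_cancel₀ _ ha.ne']

theorem hasDerivAt_rpow_mul_cpow (r : ℝ) (hr : 0 < r) (t : ℝ) {v : ℝ} (hv : 0 < v) :
    HasDerivAt (fun v : ℝ => ((v ^ a : ℝ) : ℂ) * (r - t * v * Complex.I) ^ (-a : ℂ))
      ((a * v ^ (a - 1) : ℝ) * (r * (r - t * v * Complex.I) ^ (-(a + 1) : ℂ))) v := by
  have hslit : (r - t * v * Complex.I : ℂ) ∈ Complex.slitPlane := Or.inl (by simpa using hr)
  have hpow : HasDerivAt (fun v : ℝ => ((v ^ a : ℝ) : ℂ)) ((a * v ^ (a - 1) : ℝ) : ℂ) v :=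
    (Real.hasDerivAt_rpow_const (Or.inl hv.ne')).ofReal_comp
  have hlin : HasDerivAt (fun v : ℝ => (r - t * v * Complex.I : ℂ)) (-(t * Complex.I)) v := by
    simpa using (((hasDerivAt_id v).ofReal_comp.const_mul (t : ℂ)).mul_const Complex.I).const_sub
      (r : ℂ)
  convert! hpow.mul
    ((((hasDerivAt_id _).cpow_const (c := (-a : ℂ)) hslit)).comp v hlin) using 1
  have hva : v ^ a = v ^ (a - 1) * v := by rw [← Real.rpow_add_one hv.ne', sub_add_cancel]
  have hcpow : (r - t * v * Complex.I : ℂ) ^ (-a : ℂ) =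
      (r - t * v * Complex.I) ^ (-(a + 1) : ℂ) * (r - t * v * Complex.I) := by
    rw [neg_add, Complex.cpow_add _ _ (Complex.slitPlane_ne_zero hslit), Complex.cpow_neg_one,
      inv_mul_cancel_right₀ (Complex.slitPlane_ne_zero hslit)]
  simp only [Function.comp_apply, id_eq]
  rw [hcpow, hva, show (-a - 1 : ℂ) = -(a + 1) by ring]
  push_cast
  ring

theorem integral_charFun_gammaMeasure_betaMeasure (ha : 0 < a) (hr : 0 < r) (t : ℝ) :
    ∫ v, charFun (gammaMeasure (a + 1) r) (t * v) ∂(betaMeasure a 1) =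
      charFun (gammaMeasure a r) t := by
  have hre (v : ℝ) : (r - t * v * Complex.I : ℂ) ∈ Complex.slitPlane := Or.inl (by simpa using hr)
  have hcont (c : ℂ) : Continuous fun v : ℝ => (r - t * v * Complex.I : ℂ) ^ c :=
    Continuous.cpow (by fun_prop) continuous_const hre
  have hdens : IntervalIntegrable (fun v : ℝ => a * v ^ (a - 1)) volume 0 1 :=
    (intervalIntegral.intervalIntegrable_rpow' (by linarith)).const_mul a
  have hint := intervalIntegral.integral_eq_sub_of_hasDerivAt_of_le zero_le_one
    (f := fun v : ℝ => ((v ^ a : ℝ) : ℂ) * (r - t * v * Complex.I) ^ (-a : ℂ))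
    (f' := fun v : ℝ =>
      ((a * v ^ (a - 1) : ℝ) : ℂ) * (r * (r - t * v * Complex.I) ^ (-(a + 1) : ℂ)))
    ((Complex.continuous_ofReal.comp (Real.continuous_rpow_const ha.le)).mul
      (hcont _)).continuousOn
    (fun v hv => hasDerivAt_rpow_mul_cpow r hr t hv.1)
    (IntervalIntegrable.mul_continuousOn ⟨hdens.1.ofReal, hdens.2.ofReal⟩
      ((hcont _).const_mul _).continuousOn)
  have hr1 : (r : ℂ) ^ ((a + 1 : ℝ) : ℂ) = r ^ (a : ℂ) * r := by
    rw [Complex.ofReal_add, Complex.ofReal_one, Complex.cpow_add _ _ (by exact_mod_cast hr.ne'),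
      Complex.cpow_one]
  have hintegrand (v : ℝ) : (a * v ^ (a - 1)) • charFun (gammaMeasure (a + 1) r) (t * v) =
      r ^ (a : ℂ) *
        (((a * v ^ (a - 1) : ℝ) : ℂ) * (r * (r - t * v * Complex.I) ^ (-(a + 1) : ℂ))) := by
    rw [charFun_gammaMeasure (by positivity) hr, hr1, Complex.real_smul]
    push_cast
    ring
  rw [integral_betaMeasure_one_right ha, charFun_gammaMeasure ha hr]
  simp_rw [hintegrand]
  rw [intervalIntegral.integral_const_mul, hint]
  simp [Real.zero_rpow ha.ne']

theorem map_mul_gammaMeasure_prod_betaMeasure (ha : 0 < a) (hr : 0 < r) :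
    ((gammaMeasure (a + 1) r).prod (betaMeasure a 1)).map (fun p => p.1 * p.2) =
      gammaMeasure a r := by
  have := isProbabilityMeasure_gammaMeasure ha hr
  have := isProbabilityMeasure_gammaMeasure (a := a + 1) (by positivity) hr
  have := isProbabilityMeasureBeta ha one_pos
  have hm : Measurable fun p : ℝ × ℝ => p.1 * p.2 := by fun_prop
  have := Measure.isProbabilityMeasure_map
    (μ := (gammaMeasure (a + 1) r).prod (betaMeasure a 1)) hm.aemeasurable
  refine Measure.ext_of_charFun (funext fun t => ?_)
  rw [← integral_charFun_gammaMeasure_betaMeasure ha hr, charFun_apply_real,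
    integral_map hm.aemeasurable (by fun_prop), integral_prod_symm]
  · congr with v
    rw [charFun_apply_real]
    congr with x
    push_cast
    ring_nf
  · refine Integrable.of_bound (C := 1) (by fun_prop) (ae_of_all _ fun p => ?_)
    rw [← Complex.ofReal_mul, Complex.norm_exp_ofReal_mul_I]

end GammaBeta

section ComplexGaussian

theorem real_inner_eq_re {n : ℕ} (x y : EuclideanSpace ℂ (Fin n)) :
    inner ℝ x y = (inner ℂ x y).re := by
  simp [PiLp.inner_apply]

theorem finrank_real_euclideanSpace_complex (n : ℕ) :
    Module.finrank ℝ (EuclideanSpace ℂ (Fin n)) = 2 * n := by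
  rw [← Module.finrank_mul_finrank ℝ ℂ, Complex.finrank_real_complex, finrank_euclideanSpace_fin]

theorem nontrivial_euclideanSpace_complex {n : ℕ} (hn : 0 < n) :
    Nontrivial (EuclideanSpace ℂ (Fin n)) := by
  refine Module.nontrivial_of_finrank_pos (R := ℝ) ?_
  rw [finrank_real_euclideanSpace_complex]
  positivity

theorem measurable_complex_mk : Measurable (fun p : ℝ × ℝ => (⟨p.1, p.2⟩ : ℂ)) :=
  Complex.measurableEquivRealProd.symm.measurable

instance (v : ℝ) : IsProbabilityMeasure (complexGaussian v) :=
  Measure.isProbabilityMeasure_map measurable_complex_mk.aemeasurable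

instance (L : ℕ) (v : ℝ) : IsProbabilityMeasure (complexGaussianVec L v) :=
  Measure.isProbabilityMeasure_map (by fun_prop)

theorem charFun_complexGaussian {v : ℝ} (hv : 0 ≤ v) (t : ℂ) :
    charFun (complexGaussian v) t = Complex.exp (-(v * ‖t‖ ^ 2 / 4 : ℝ)) := by
  rw [charFun_apply, complexGaussian, integral_map measurable_complex_mk.aemeasurable
    (by fun_prop)]
  have hsplit (p : ℝ × ℝ) : Complex.exp ((inner ℝ (⟨p.1, p.2⟩ : ℂ) t : ℝ) * Complex.I) =
      Complex.exp ((t.re : ℂ) * p.1 * Complex.I) *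
        Complex.exp ((t.im : ℂ) * p.2 * Complex.I) := by
    rw [← Complex.exp_add, Complex.inner]
    congr 1
    simp only [Complex.mul_re, Complex.conj_re, Complex.conj_im, Complex.ofReal_sub,
      Complex.ofReal_mul, Complex.ofReal_neg]
    ring
  simp_rw [hsplit]
  rw [integral_prod_mul (fun x : ℝ => Complex.exp ((t.re : ℂ) * x * Complex.I))
    (fun x : ℝ => Complex.exp ((t.im : ℂ) * x * Complex.I)), ← charFun_apply_real,
    ← charFun_apply_real, charFun_gaussianReal, charFun_gaussianReal, ← Complex.exp_add]
  congr 1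
  rw [Real.coe_toNNReal _ (by positivity), Complex.sq_norm, Complex.normSq_apply]
  push_cast
  ring

theorem charFun_complexGaussianVec (n : ℕ) {v : ℝ} (hv : 0 ≤ v) (t : EuclideanSpace ℂ (Fin n)) :
    charFun (complexGaussianVec n v) t = Complex.exp (-(v * ‖t‖ ^ 2 / 4 : ℝ)) := by
  rw [complexGaussianVec, charFun_pi]
  simp_rw [charFun_complexGaussian hv]
  rw [← Complex.exp_sum, EuclideanSpace.norm_sq_eq]
  congr 1
  push_cast
  rw [Finset.sum_neg_distrib, Finset.mul_sum, Finset.sum_div]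

/-- The density of `complexGaussianVec n v` as a function of the norm `r` of the vector, with
respect to the Lebesgue measure of the real Euclidean space `ℂⁿ ≅ ℝ²ⁿ`. -/
noncomputable def gaussianDensity (n : ℕ) (v r : ℝ) : ℝ :=
  ((Real.pi * v) ^ n)⁻¹ * Real.exp (-(v⁻¹) * r ^ 2)

theorem gaussianDensity_nonneg (n : ℕ) {v : ℝ} (hv : 0 ≤ v) (r : ℝ) :
    0 ≤ gaussianDensity n v r := by
  unfold gaussianDensity
  positivity

theorem measurable_gaussianDensity (n : ℕ) (v : ℝ) : Measurable (gaussianDensity n v) := by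
  unfold gaussianDensity
  fun_prop

theorem integral_gaussianDensity_smul (n : ℕ) {v : ℝ} (hv : 0 < v)
    (f : EuclideanSpace ℂ (Fin n) → ℂ) :
    ∫ z, f z ∂(volume.withDensity fun z => ENNReal.ofReal (gaussianDensity n v ‖z‖)) =
      (((Real.pi * v) ^ n)⁻¹ : ℝ) * ∫ z, Complex.exp (-(v⁻¹ : ℝ) * ‖z‖ ^ 2) * f z := by
  have hm : Measurable fun z : EuclideanSpace ℂ (Fin n) =>
      ENNReal.ofReal (gaussianDensity n v ‖z‖) :=
    ((measurable_gaussianDensity n v).comp measurable_norm).ennreal_ofReal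
  rw [integral_withDensity_eq_integral_toReal_smul hm (by simp), ← integral_const_mul]
  congr with z
  rw [ENNReal.toReal_ofReal (gaussianDensity_nonneg n hv.le _), gaussianDensity,
    Complex.real_smul]
  push_cast
  ring

theorem pi_div_cpow_finrank_div_two (n : ℕ) (b : ℂ) :
    ((Real.pi : ℂ) / b) ^ ((Module.finrank ℝ (EuclideanSpace ℂ (Fin n)) : ℂ) / 2) =
      (Real.pi / b) ^ n := by
  rw [finrank_real_euclideanSpace_complex, ← Complex.cpow_natCast]
  congr 1
  push_cast
  ring

theorem isProbabilityMeasure_gaussianDensity (n : ℕ) {v : ℝ} (hv : 0 < v) :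
    IsProbabilityMeasure ((volume : Measure (EuclideanSpace ℂ (Fin n))).withDensity
      fun z => ENNReal.ofReal (gaussianDensity n v ‖z‖)) := by
  constructor
  have hint : ∫ z : EuclideanSpace ℂ (Fin n), gaussianDensity n v ‖z‖ = 1 := by
    unfold gaussianDensity
    rw [integral_const_mul, GaussianFourier.integral_rexp_neg_mul_sq_norm (by positivity),
      finrank_real_euclideanSpace_complex, Nat.cast_mul, Nat.cast_two,
      mul_div_cancel_left₀ _ two_ne_zero, Real.rpow_natCast, div_inv_eq_mul]
    exact inv_mul_cancel₀ (by positivity)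
  rw [withDensity_apply _ MeasurableSet.univ, Measure.restrict_univ,
    ← ofReal_integral_eq_lintegral_ofReal, hint, ENNReal.ofReal_one]
  · exact Integrable.of_integral_ne_zero (hint ▸ one_ne_zero)
  · exact ae_of_all _ fun z => gaussianDensity_nonneg n hv.le _

theorem complexGaussianVec_eq_withDensity (n : ℕ) {v : ℝ} (hv : 0 < v) :
    complexGaussianVec n v =
      volume.withDensity fun z => ENNReal.ofReal (gaussianDensity n v ‖z‖) := by
  have := isProbabilityMeasure_gaussianDensity n hv
  refine Measure.ext_of_charFun (funext fun t => ?_)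
  rw [charFun_complexGaussianVec n hv.le, charFun_apply, integral_gaussianDensity_smul n hv]
  simp_rw [← Complex.exp_add, real_inner_comm t, mul_comm _ Complex.I]
  have hv' : (v : ℂ) ≠ 0 := by exact_mod_cast hv.ne'
  rw [GaussianFourier.integral_cexp_neg_mul_sq_norm_add (by simpa using hv),
    pi_div_cpow_finrank_div_two]
  have hπ : (Real.pi : ℂ) ≠ 0 := by exact_mod_cast Real.pi_ne_zero
  push_cast
  rw [div_inv_eq_mul, ← mul_assoc, inv_mul_cancel₀ (pow_ne_zero n (mul_ne_zero hπ hv')), one_mul,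
    Complex.I_sq]
  congr 1
  field_simp

theorem map_norm_sq_div_complexGaussianVec {n : ℕ} (hn : 0 < n) {v : ℝ} (hv : 0 < v) :
    (complexGaussianVec n v).map (fun z => ‖z‖ ^ 2 / v) = gammaMeasure n 1 := by
  have hn' : (0 : ℝ) < n := by exact_mod_cast hn
  have hv' : (v : ℂ) ≠ 0 := by exact_mod_cast hv.ne'
  have hπ : (Real.pi : ℂ) ≠ 0 := by exact_mod_cast Real.pi_ne_zero
  have hm : Measurable fun z : EuclideanSpace ℂ (Fin n) => ‖z‖ ^ 2 / v := by fun_prop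
  have := isProbabilityMeasure_gammaMeasure hn' one_pos
  have := Measure.isProbabilityMeasure_map (μ := complexGaussianVec n v) hm.aemeasurable
  refine Measure.ext_of_charFun (funext fun t => ?_)
  have hre : (1 - t * Complex.I : ℂ).re = 1 := by simp
  have ht : (1 - t * Complex.I : ℂ) ≠ 0 := fun h => by simp [h] at hre
  have hexp (z : EuclideanSpace ℂ (Fin n)) :
      Complex.exp (-(v⁻¹ : ℝ) * ‖z‖ ^ 2) * Complex.exp (t * (‖z‖ ^ 2 / v : ℝ) * Complex.I) =
        Complex.exp (-((1 - t * Complex.I) / v) * ‖z‖ ^ 2) := by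
    rw [← Complex.exp_add]
    congr 1
    push_cast
    ring
  have hb : 0 < ((1 - t * Complex.I) / v : ℂ).re := by
    rw [Complex.div_ofReal_re, hre]
    positivity
  rw [charFun_gammaMeasure hn' one_pos, charFun_apply_real, integral_map hm.aemeasurable
    (by fun_prop), complexGaussianVec_eq_withDensity n hv, integral_gaussianDensity_smul n hv]
  simp_rw [hexp]
  rw [GaussianFourier.integral_cexp_neg_mul_sq_norm hb, pi_div_cpow_finrank_div_two]
  simp only [Complex.ofReal_natCast, Complex.cpow_neg, Complex.cpow_natCast]
  push_cast
  field_simp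
  rw [← mul_pow, div_mul_cancel₀ _ ht, one_pow, mul_one]

theorem map_repr_orthogonalProjectionOnto_complexGaussianVec {n m : ℕ}
    {V : Submodule ℂ (EuclideanSpace ℂ (Fin n))} (b : OrthonormalBasis (Fin m) ℂ V) {v : ℝ}
    (hv : 0 ≤ v) :
    (complexGaussianVec n v).map (fun h => b.repr (V.orthogonalProjectionOnto h)) =
      complexGaussianVec m v := by
  have hm : Measurable fun h => b.repr (V.orthogonalProjectionOnto h) :=
    Continuous.measurable (by fun_prop)
  have := Measure.isProbabilityMeasure_map (μ := complexGaussianVec n v) hm.aemeasurable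
  refine Measure.ext_of_charFun (funext fun t => ?_)
  have hinner (h : EuclideanSpace ℂ (Fin n)) :
      inner ℝ (b.repr (V.orthogonalProjectionOnto h)) t =
        inner ℝ h (b.repr.symm t : EuclideanSpace ℂ (Fin n)) := by
    rw [real_inner_eq_re, real_inner_eq_re, LinearIsometryEquiv.inner_map_eq_flip,
      Submodule.inner_orthogonalProjectionOnto_eq_of_mem_right]
  have hnorm : ‖(b.repr.symm t : EuclideanSpace ℂ (Fin n))‖ = ‖t‖ := b.repr.symm.norm_map t
  rw [charFun_apply, integral_map hm.aemeasurable (by fun_prop)]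
  simp_rw [hinner]
  rw [← charFun_apply, charFun_complexGaussianVec _ hv, charFun_complexGaussianVec _ hv, hnorm]

theorem norm_sq_orthogonalProjectionOnto_span_singleton_orthogonal {𝕜 E : Type*} [RCLike 𝕜]
    [NormedAddCommGroup E] [InnerProductSpace 𝕜 E] [FiniteDimensional 𝕜 E] {s : E}
    (hs : ‖s‖ = 1) (h : E) :
    ‖(Submodule.span 𝕜 {s})ᗮ.orthogonalProjectionOnto h‖ ^ 2 = ‖h‖ ^ 2 - ‖inner 𝕜 s h‖ ^ 2 := by
  have hpyth := Submodule.norm_sq_eq_add_norm_sq_projection h (Submodule.span 𝕜 {s})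
  have hspan : ‖(Submodule.span 𝕜 {s}).orthogonalProjectionOnto h‖ = ‖inner 𝕜 s h‖ := by
    change ‖(Submodule.span 𝕜 {s}).starProjection h‖ = _
    rw [Submodule.starProjection_unit_singleton 𝕜 hs, norm_smul, hs, mul_one]
  rw [hpyth, hspan, add_sub_cancel_left]

theorem map_norm_sq_sub_norm_inner_sq_complexGaussianVec {n : ℕ} (hn : 0 < n) {v : ℝ} (hv : 0 < v)
    {s : EuclideanSpace ℂ (Fin (n + 1))} (hs : ‖s‖ = 1) :
    (complexGaussianVec (n + 1) v).map (fun h => (‖h‖ ^ 2 - ‖inner ℂ s h‖ ^ 2) / v) =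
      gammaMeasure n 1 := by
  have : Fact (Module.finrank ℂ (EuclideanSpace ℂ (Fin (n + 1))) = n + 1) := ⟨by simp⟩
  have hs0 : s ≠ 0 := norm_ne_zero_iff.mp (by simp [hs])
  have hfinrank : Module.finrank ℂ (Submodule.span ℂ {s})ᗮ = n :=
    Submodule.finrank_orthogonal_span_singleton hs0
  let b := (stdOrthonormalBasis ℂ (Submodule.span ℂ {s})ᗮ).reindex (finCongr hfinrank)
  rw [← map_norm_sq_div_complexGaussianVec hn hv,
    ← map_repr_orthogonalProjectionOnto_complexGaussianVec b hv.le,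
    Measure.map_map (by fun_prop) (Continuous.measurable (by fun_prop))]
  congr with h
  rw [Function.comp_apply, LinearIsometryEquiv.norm_map,
    norm_sq_orthogonalProjectionOnto_span_singleton_orthogonal hs]

end ComplexGaussian

section Radial

open scoped ENNReal

variable {E : Type*} [NormedAddCommGroup E] [NormedSpace ℝ E] [FiniteDimensional ℝ E]
  [Nontrivial E] [MeasurableSpace E] [BorelSpace E] (μ : Measure E) [μ.IsAddHaarMeasure]

theorem lintegral_inv_norm_smul_mul_norm {k : E → ℝ≥0∞} (hk : Measurable k) {g : ℝ → ℝ≥0∞}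
    (hg : Measurable g) :
    ∫⁻ z, k (‖z‖⁻¹ • z) * g ‖z‖ ∂μ = (∫⁻ s, k s.1 ∂μ.toSphere) *
      ∫⁻ r, g r.1 ∂(Measure.volumeIoiPow (Module.finrank ℝ E - 1)) := by
  have hpolar := μ.measurePreserving_homeomorphUnitSphereProd.lintegral_comp
    (f := fun p => k p.1.1 * g p.2.1)
    ((hk.comp (measurable_subtype_coe.comp measurable_fst)).mul
      (hg.comp (measurable_subtype_coe.comp measurable_snd)))
  have hcompl : ∫⁻ z, k (‖z‖⁻¹ • z) * g ‖z‖ ∂μ =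
      ∫⁻ z in ({0}ᶜ : Set E), k (‖z‖⁻¹ • z) * g ‖z‖ ∂μ := by rw [restrict_compl_singleton]
  have hprod := lintegral_prod_mul (μ := μ.toSphere)
    (ν := Measure.volumeIoiPow (Module.finrank ℝ E - 1)) (f := fun s => k s.1)
    (g := fun r => g r.1) (hk.comp measurable_subtype_coe).aemeasurable
    (hg.comp measurable_subtype_coe).aemeasurable
  rw [hcompl, ← hprod, ← hpolar, ← lintegral_subtype_comap (measurableSet_singleton _).compl]
  refine lintegral_congr fun z => ?_
  simp

theorem indepFun_norm_inv_norm_smul_withDensity {f : ℝ → ℝ≥0∞} (hf : Measurable f)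
    [IsProbabilityMeasure (μ.withDensity fun z => f ‖z‖)] :
    IndepFun (fun z => ‖z‖) (fun z => ‖z‖⁻¹ • z) (μ.withDensity fun z => f ‖z‖) := by
  set ν := μ.withDensity fun z => f ‖z‖
  have hdir : Measurable fun z : E => ‖z‖⁻¹ • z := by fun_prop
  have hprod (A : Set ℝ) (S : Set E) (hA : MeasurableSet A) (hS : MeasurableSet S) :
      ν ((‖·‖) ⁻¹' A ∩ (fun z => ‖z‖⁻¹ • z) ⁻¹' S) =
      (∫⁻ s, S.indicator 1 s.1 ∂μ.toSphere) *
        ∫⁻ r, A.indicator 1 r.1 * f r.1 ∂(Measure.volumeIoiPow (Module.finrank ℝ E - 1)) := by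
    have hAS := (measurable_norm hA).inter (hdir hS)
    rw [← lintegral_inv_norm_smul_mul_norm μ (measurable_one.indicator hS)
      (g := fun r => A.indicator 1 r * f r) ((measurable_one.indicator hA).mul hf),
      withDensity_apply _ hAS, ← lintegral_indicator hAS]
    refine lintegral_congr fun z => ?_
    by_cases hzA : ‖z‖ ∈ A <;> by_cases hzS : ‖z‖⁻¹ • z ∈ S <;> simp [hzA, hzS, Set.indicator]
  rw [indepFun_iff_measure_inter_preimage_eq_mul]
  intro A S hA hS
  have hνA := hprod A Set.univ hA .univ
  have hνS := hprod Set.univ S .univ hS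
  have hν := hprod Set.univ Set.univ .univ .univ
  simp only [Set.preimage_univ, Set.inter_univ, Set.univ_inter, measure_univ] at hνA hνS hν
  rw [hprod A S hA hS, hνA, hνS]
  refine (one_mul _).symm.trans ?_
  rw [hν]
  ring

end Radial

section Shape

variable {n : ℕ}

theorem shape_eq_inv_norm_smul (h : EuclideanSpace ℂ (Fin n)) : shape h = ‖h‖⁻¹ • h :=
  Complex.coe_smul _ _

@[fun_prop]
theorem measurable_shape : Measurable (shape : EuclideanSpace ℂ (Fin n) → _) := by
  unfold shape
  fun_prop

theorem norm_shape {h : EuclideanSpace ℂ (Fin n)} (hh : h ≠ 0) : ‖shape h‖ = 1 := by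
  rw [shape_eq_inv_norm_smul, norm_smul, norm_inv, norm_norm,
    inv_mul_cancel₀ (norm_ne_zero_iff.mpr hh)]

theorem norm_smul_shape (h : EuclideanSpace ℂ (Fin n)) : (‖h‖ : ℂ) • shape h = h := by
  rcases eq_or_ne h 0 with rfl | hh
  · simp
  · rw [shape, smul_smul, ← Complex.ofReal_mul, mul_inv_cancel₀ (norm_ne_zero_iff.mpr hh),
      Complex.ofReal_one, one_smul]

theorem norm_sq_mul_norm_shape_sq_sub (q h : EuclideanSpace ℂ (Fin n)) :
    ‖h‖ ^ 2 * (‖shape h‖ ^ 2 - ‖inner ℂ q (shape h)‖ ^ 2) = ‖h‖ ^ 2 - ‖inner ℂ q h‖ ^ 2 := by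
  have hnorm : ‖h‖ * ‖shape h‖ = ‖h‖ := by
    simpa [norm_smul] using congrArg norm (norm_smul_shape h)
  have hinner : ‖h‖ * ‖inner ℂ q (shape h)‖ = ‖inner ℂ q h‖ := by
    simpa [inner_smul_right] using congrArg (fun v => ‖inner ℂ q v‖) (norm_smul_shape h)
  rw [mul_sub, ← mul_pow, ← mul_pow, hnorm, hinner]

theorem indepFun_norm_shape (hn : 0 < n) {v : ℝ} (hv : 0 < v) :
    IndepFun (fun z => ‖z‖) shape (complexGaussianVec n v) := by
  have := nontrivial_euclideanSpace_complex hn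
  have := isProbabilityMeasure_gaussianDensity n hv
  have hshape : (shape : EuclideanSpace ℂ (Fin n) → _) = fun z => ‖z‖⁻¹ • z :=
    funext shape_eq_inv_norm_smul
  rw [complexGaussianVec_eq_withDensity n hv, hshape]
  exact indepFun_norm_inv_norm_smul_withDensity volume
    (f := fun r => ENNReal.ofReal (gaussianDensity n v r))
    (measurable_gaussianDensity n v).ennreal_ofReal

theorem ae_ne_zero_complexGaussianVec (hn : 0 < n) {v : ℝ} (hv : 0 < v) :
    ∀ᵐ h ∂(complexGaussianVec n v), h ≠ 0 := by
  have := nontrivial_euclideanSpace_complex hn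
  rw [complexGaussianVec_eq_withDensity n hv]
  exact (withDensity_absolutelyContinuous _ _).ae_le (Measure.ae_ne _ _)

end Shape

section Independence

variable {Ω α β γ : Type*} [MeasurableSpace Ω] [MeasurableSpace α] [MeasurableSpace β]
  [MeasurableSpace γ] {μ : Measure Ω} {X : Ω → α} {Y : Ω → β}

theorem indepFun_comp_of_map {φ : α → β} {ψ : α → γ} (hX : AEMeasurable X μ) (hφ : Measurable φ)
    (hψ : Measurable ψ) (h : IndepFun φ ψ (μ.map X)) : IndepFun (φ ∘ X) (ψ ∘ X) μ := by
  rw [indepFun_iff_measure_inter_preimage_eq_mul] at h ⊢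
  intro s t hs ht
  have hst := h s t hs ht
  rwa [Measure.map_apply_of_aemeasurable hX ((hφ hs).inter (hψ ht)),
    Measure.map_apply_of_aemeasurable hX (hφ hs),
    Measure.map_apply_of_aemeasurable hX (hψ ht)] at hst

variable [IsFiniteMeasure μ]

theorem indepFun_prodMk_right {Z : Ω → γ} (hX : AEMeasurable X μ) (hY : AEMeasurable Y μ)
    (hZ : AEMeasurable Z μ) (hXY : IndepFun X Y μ)
    (hXYZ : IndepFun (fun ω => (X ω, Y ω)) Z μ) : IndepFun X (fun ω => (Y ω, Z ω)) μ := by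
  have lawX : HasLaw X (μ.map X) μ := ⟨hX, rfl⟩
  have lawY : HasLaw Y (μ.map Y) μ := ⟨hY, rfl⟩
  have lawZ : HasLaw Z (μ.map Z) μ := ⟨hZ, rfl⟩
  have hYZ : IndepFun Y Z μ := hXYZ.comp measurable_snd measurable_id
  rw [indepFun_iff_hasLaw_prodMk_prod lawX (hYZ.hasLaw_prod lawY lawZ)]
  exact (measurePreserving_prodAssoc _ _ _).hasLaw.fun_comp
    (hXYZ.hasLaw_prod (hXY.hasLaw_prod lawX lawY) lawZ)

theorem hasLaw_prodMk_of_ae_map_eq (hX : AEMeasurable X μ) (hY : AEMeasurable Y μ)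
    (hXY : IndepFun X Y μ) {g : α → β → γ} (hg : Measurable (Function.uncurry g)) {ν : Measure γ}
    (hν : ∀ᵐ x ∂(μ.map X), (μ.map Y).map (g x) = ν) :
    HasLaw (fun ω => (X ω, g (X ω) (Y ω))) ((μ.map X).prod ν) μ :=
  ((MeasurePreserving.id (μ.map X)).skew_product hg hν).hasLaw.fun_comp
    (hXY.hasLaw_prod ⟨hX, rfl⟩ ⟨hY, rfl⟩)

end Independence

theorem norm_inner_sq_of_isMaxOn {𝕜 E : Type*} [RCLike 𝕜] [NormedAddCommGroup E]
    [InnerProductSpace 𝕜 E] {V : Submodule 𝕜 E} [V.HasOrthogonalProjection] {s f : E} {P : ℝ}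
    (hP : 0 ≤ P) (hfV : f ∈ V) (hfP : ‖f‖ ^ 2 ≤ P)
    (hmax : IsMaxOn (fun v => ‖inner 𝕜 v s‖ ^ 2) {v | v ∈ V ∧ ‖v‖ ^ 2 ≤ P} f) :
    ‖inner 𝕜 f s‖ ^ 2 = P * ‖V.orthogonalProjectionOnto s‖ ^ 2 := by
  set p := V.orthogonalProjectionOnto s
  have hproj {v : E} (hv : v ∈ V) : inner 𝕜 v s = inner 𝕜 v (p : E) :=
    (Submodule.inner_orthogonalProjectionOnto_eq_of_mem_left ⟨v, hv⟩ s).symm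
  apply le_antisymm
  · calc ‖inner 𝕜 f s‖ ^ 2 ≤ (‖f‖ * ‖p‖) ^ 2 := by
          rw [hproj hfV]
          gcongr
          exact norm_inner_le_norm f p.1
      _ = ‖f‖ ^ 2 * ‖p‖ ^ 2 := mul_pow _ _ 2
      _ ≤ P * ‖p‖ ^ 2 := by gcongr
  · rcases eq_or_ne ‖p‖ 0 with hp | hp
    · simp [hp]
    set v : E := ((√P / ‖p‖ : ℝ) : 𝕜) • p.1
    have hv : v ∈ V := V.smul_mem _ p.2
    have hnorm : ‖v‖ ^ 2 = P := by
      rw [norm_smul, RCLike.norm_ofReal, abs_of_nonneg (by positivity), ← Submodule.coe_norm,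
        div_mul_cancel₀ _ hp, Real.sq_sqrt hP]
    have hinner : ‖inner 𝕜 v s‖ ^ 2 = P * ‖p‖ ^ 2 := by
      rw [hproj hv, inner_smul_left, inner_self_eq_norm_sq_to_K, norm_mul, RCLike.norm_conj]
      simp only [RCLike.norm_ofReal, norm_pow, abs_div, abs_norm, Submodule.coe_norm]
      rw [abs_of_nonneg (Real.sqrt_nonneg P), mul_pow, div_pow, Real.sq_sqrt hP]
      field_simp
    exact hinner ▸ hmax ⟨hv, hnorm.le⟩

theorem IsOCB.norm_inner_sq {n : ℕ} {q s f : EuclideanSpace ℂ (Fin n)} {P : ℝ} (hq : ‖q‖ = 1)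
    (hP : 0 ≤ P) (hf : IsOCB q s P f) :
    ‖inner ℂ f s‖ ^ 2 = P * (‖s‖ ^ 2 - ‖inner ℂ q s‖ ^ 2) := by
  obtain ⟨⟨hfq, hfP⟩, hmax⟩ := hf
  simp only [← Submodule.mem_orthogonal_singleton_iff_inner_left (𝕜 := ℂ)] at hfq hmax
  rw [norm_inner_sq_of_isMaxOn hP hfq hfP hmax,
    norm_sq_orthogonalProjectionOnto_span_singleton_orthogonal hq]

section Quantizer

theorem quantError_nonneg {n : ℕ} {q s : EuclideanSpace ℂ (Fin n)} (hq : ‖q‖ = 1)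
    (hs : ‖s‖ = 1) : 0 ≤ quantError q s := by
  have hinner : ‖inner ℂ q s‖ ≤ 1 := by simpa [hq, hs] using norm_inner_le_norm (𝕜 := ℂ) q s
  exact sub_nonneg.mpr (pow_le_one₀ (norm_nonneg _) hinner)

@[fun_prop]
theorem measurable_quantError {X : Type*} [MeasurableSpace X] {n : ℕ}
    {f g : X → EuclideanSpace ℂ (Fin n)} (hf : Measurable f) (hg : Measurable g) :
    Measurable fun x => quantError (f x) (g x) := by
  unfold quantError
  fun_prop

/-- The factor `2 ^ (-B / n)` by which `B` feedback bits shrink the quantization error of a shape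
in `ℂⁿ⁺¹`; the number of antennas is `n + 1`. -/
noncomputable def decay (n B : ℕ) : ℝ := (2 : ℝ) ^ (-(B : ℝ) / n)

theorem decay_pos (n B : ℕ) : 0 < decay n B := Real.rpow_pos_of_pos two_pos _

theorem decay_pow {n : ℕ} (hn : 0 < n) (B : ℕ) : decay n B ^ n = (2 ^ B)⁻¹ := by
  have hn' : (n : ℝ) ≠ 0 := by positivity
  rw [decay, ← Real.rpow_natCast, ← Real.rpow_mul two_pos.le, div_mul_cancel₀ _ hn',
    Real.rpow_neg two_pos.le, Real.rpow_natCast]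

theorem eq_betaMeasure_one_right {a : ℝ} (ha : 0 < a) {ν : Measure ℝ} [IsProbabilityMeasure ν]
    (hν : ∀ x, 0 ≤ x → x ≤ 1 → ν.real (Set.Iic x) = x ^ a) : ν = betaMeasure a 1 := by
  have := isProbabilityMeasureBeta ha one_pos
  have hunit {x : ℝ} (hx0 : 0 ≤ x) (hx1 : x ≤ 1) :
      ν.real (Set.Iic x) = (betaMeasure a 1).real (Set.Iic x) := by
    rw [hν x hx0 hx1, betaMeasure_one_right_real_Iic ha hx0 hx1]
  have hneg {ρ : Measure ℝ} [IsFiniteMeasure ρ] (hρ : ρ.real (Set.Iic 0) = 0) {x : ℝ}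
      (hx : x ≤ 0) : ρ.real (Set.Iic x) = 0 :=
    measureReal_mono_null (Set.Iic_subset_Iic.mpr hx) hρ
  have hone {ρ : Measure ℝ} [IsProbabilityMeasure ρ] (hρ : ρ.real (Set.Iic 1) = 1) {x : ℝ}
      (hx : 1 ≤ x) : ρ.real (Set.Iic x) = 1 :=
    le_antisymm measureReal_le_one (hρ ▸ measureReal_mono (Set.Iic_subset_Iic.mpr hx))
  have hν0 : ν.real (Set.Iic 0) = 0 := by rw [hν 0 le_rfl zero_le_one, Real.zero_rpow ha.ne']
  have hν1 : ν.real (Set.Iic 1) = 1 := by rw [hν 1 zero_le_one le_rfl, Real.one_rpow]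
  refine Measure.ext_of_Iic _ _ fun x => (measureReal_eq_measureReal_iff ..).mp ?_
  rcases le_total x 0 with hx0 | hx0
  · rw [hneg hν0 hx0, hneg ((hunit le_rfl zero_le_one).symm.trans hν0) hx0]
  rcases le_total x 1 with hx1 | hx1
  · exact hunit hx0 hx1
  · rw [hone hν1 hx1, hone ((hunit zero_le_one le_rfl).symm.trans hν1) hx1]

end Quantizer

namespace SystemModel

variable {Ω 𝒰 : Type*} [MeasurableSpace Ω] [MeasurableSpace 𝒰] {μ : Measure Ω} {n : ℕ} {lam : ℝ}
  {B : ℕ} (M : SystemModel (𝒰 := 𝒰) μ (n + 1) lam B)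

attribute [fun_prop] measurable_gp measurable_hx measurable_hs measurable_U

@[fun_prop]
theorem measurable_Q_apply {X : Type*} [MeasurableSpace X]
    {f : X → EuclideanSpace ℂ (Fin (n + 1))} {g : X → 𝒰} (hf : Measurable f) (hg : Measurable g) :
    Measurable fun x => M.Q (f x) (g x) :=
  M.measurable_Q.comp (hf.prodMk hg)

@[fun_prop]
theorem measurable_sxHat : Measurable M.sxHat := by
  unfold sxHat
  fun_prop

@[fun_prop]
theorem measurable_gx : Measurable M.gx := by
  unfold gx
  fun_prop

/-- The effective secondary channel power `‖hₛ‖² - |ŝₓ† hₛ|²`: the part of the secondary channel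
orthogonal to the quantized interference channel. -/
noncomputable def orthGain (ω : Ω) : ℝ := ‖M.hs ω‖ ^ 2 - ‖inner ℂ (M.sxHat ω) (M.hs ω)‖ ^ 2

@[fun_prop]
theorem measurable_orthGain : Measurable M.orthGain := by
  unfold orthGain
  fun_prop

/-- The interference leakage `gₓ ε` divided by `decay n B`; with this normalization its law does
not depend on `B`. -/
noncomputable def leakage (ω : Ω) : ℝ :=
  M.gx ω * (quantError (M.sxHat ω) (shape (M.hx ω)) / decay n B)

@[fun_prop]
theorem measurable_leakage : Measurable M.leakage := by
  unfold leakage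
  fun_prop

theorem ae_hx_ne_zero (hlam : 0 < lam) : ∀ᵐ ω ∂μ, M.hx ω ≠ 0 :=
  ae_of_ae_map M.measurable_hx.aemeasurable
    (M.law_hx ▸ ae_ne_zero_complexGaussianVec n.succ_pos hlam)

theorem ae_norm_sxHat (hlam : 0 < lam) : ∀ᵐ ω ∂μ, ‖M.sxHat ω‖ = 1 :=
  (M.ae_hx_ne_zero hlam).mono fun _ hω => M.norm_Q _ _ (norm_shape hω)

theorem indepFun_gp_orthGain_leakage : IndepFun M.gp (fun ω => (M.orthGain ω, M.leakage ω)) μ := by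
  have hfun : Measurable fun p : EuclideanSpace ℂ (Fin (n + 1)) ×
      EuclideanSpace ℂ (Fin (n + 1)) × 𝒰 =>
      (‖p.2.1‖ ^ 2 - ‖inner ℂ (M.Q (shape p.1) p.2.2) p.2.1‖ ^ 2,
        ‖p.1‖ ^ 2 / lam * (quantError (M.Q (shape p.1) p.2.2) (shape p.1) / decay n B)) := by
    fun_prop
  exact M.indep_gp.comp measurable_id hfun

variable [IsProbabilityMeasure μ]

theorem hasLaw_quantError_div_decay (hn : 0 < n) :
    HasLaw (fun ω => quantError (M.sxHat ω) (shape (M.hx ω)) / decay n B) (betaMeasure n 1) μ := by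
  have hm : Measurable fun ω => quantError (M.sxHat ω) (shape (M.hx ω)) / decay n B := by fun_prop
  have := Measure.isProbabilityMeasure_map (μ := μ) hm.aemeasurable
  have hδ := decay_pos n B
  refine ⟨hm.aemeasurable, eq_betaMeasure_one_right (by exact_mod_cast hn) fun x hx0 hx1 => ?_⟩
  have hcdf := M.quantError_cdf (decay n B * x) (by positivity)
    ((mul_le_of_le_one_right hδ.le hx1).trans_eq (by simp [decay]))
  rw [Nat.add_sub_cancel, mul_pow, decay_pow hn, mul_inv_cancel_left₀ (by positivity)] at hcdf
  rw [map_measureReal_apply hm measurableSet_Iic, Real.rpow_natCast, ← hcdf]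
  congr 1 with ω
  exact div_le_iff₀' hδ

theorem indepFun_norm_hx_shape_hx_U (hlam : 0 < lam) :
    IndepFun (fun ω => ‖M.hx ω‖) (fun ω => (shape (M.hx ω), M.U ω)) μ := by
  have hpolar : IndepFun (fun ω => ‖M.hx ω‖) (fun ω => shape (M.hx ω)) μ :=
    indepFun_comp_of_map M.measurable_hx.aemeasurable measurable_norm measurable_shape
      (M.law_hx ▸ indepFun_norm_shape n.succ_pos hlam)
  have hxU : IndepFun M.hx M.U μ := M.indep_hx.comp measurable_id measurable_snd
  exact indepFun_prodMk_right (by fun_prop) (by fun_prop) (by fun_prop) hpolar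
    (hxU.comp (φ := fun h => (‖h‖, shape h)) (by fun_prop) measurable_id)

theorem indepFun_gx_quantError (hlam : 0 < lam) :
    IndepFun M.gx (fun ω => quantError (M.sxHat ω) (shape (M.hx ω))) μ := by
  have hgain : Measurable fun r : ℝ => r ^ 2 / lam := by fun_prop
  have herror : Measurable fun p : EuclideanSpace ℂ (Fin (n + 1)) × 𝒰 =>
      quantError (M.Q p.1 p.2) p.1 := by fun_prop
  exact (M.indepFun_norm_hx_shape_hx_U hlam).comp hgain herror

theorem hasLaw_leakage (hn : 0 < n) (hlam : 0 < lam) :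
    HasLaw M.leakage (gammaMeasure n 1) μ := by
  have hn' : (0 : ℝ) < n := by exact_mod_cast hn
  have hgain : HasLaw M.gx (gammaMeasure (n + 1) 1) μ := by
    have h := map_norm_sq_div_complexGaussianVec n.succ_pos hlam
    rw [Nat.cast_succ, ← M.law_hx, Measure.map_map (by fun_prop) (by fun_prop)] at h
    exact ⟨by fun_prop, h⟩
  have hindep := (M.indepFun_gx_quantError hlam).comp measurable_id
    (measurable_id.div_const (decay n B))
  have hmul : HasLaw (fun p : ℝ × ℝ => p.1 * p.2) (gammaMeasure n 1)
      ((gammaMeasure (n + 1) 1).prod (betaMeasure n 1)) :=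
    ⟨by fun_prop, map_mul_gammaMeasure_prod_betaMeasure hn' one_pos⟩
  exact hmul.fun_comp (hindep.hasLaw_prod hgain (M.hasLaw_quantError_div_decay hn))

theorem hasLaw_prodMk_orthGain (hn : 0 < n) (hlam : 0 < lam) :
    HasLaw (fun ω => ((M.U ω, M.hx ω), M.orthGain ω))
      ((μ.map fun ω => (M.U ω, M.hx ω)).prod (gammaMeasure n 1)) μ := by
  have hindep : IndepFun (fun ω => (M.U ω, M.hx ω)) M.hs μ :=
    (indepFun_prodMk_right (by fun_prop) (by fun_prop) (by fun_prop) M.indep_hs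
      M.indep_hx.symm).symm
  refine hasLaw_prodMk_of_ae_map_eq (by fun_prop) (by fun_prop) hindep
    (g := fun p h => ‖h‖ ^ 2 - ‖inner ℂ (M.Q (shape p.2) p.1) h‖ ^ 2) ?_ ?_
  · unfold Function.uncurry
    fun_prop
  · have hnorm : Measurable fun p : 𝒰 × EuclideanSpace ℂ (Fin (n + 1)) =>
        ‖M.Q (shape p.2) p.1‖ := by fun_prop
    have hae : ∀ᵐ p ∂(μ.map fun ω => (M.U ω, M.hx ω)), ‖M.Q (shape p.2) p.1‖ = 1 :=
      (ae_map_iff (by fun_prop) (hnorm (measurableSet_singleton 1))).mpr (M.ae_norm_sxHat hlam)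
    filter_upwards [hae] with p hp
    simpa [M.law_hs] using map_norm_sq_sub_norm_inner_sq_complexGaussianVec hn one_pos hp

theorem hasLaw_orthGain (hn : 0 < n) (hlam : 0 < lam) : HasLaw M.orthGain (gammaMeasure n 1) μ := by
  have := Measure.isProbabilityMeasure_map (μ := μ) (f := fun ω => (M.U ω, M.hx ω)) (by fun_prop)
  have := isProbabilityMeasure_gammaMeasure (a := n) (by exact_mod_cast hn) one_pos
  exact measurePreserving_snd.hasLaw.fun_comp (M.hasLaw_prodMk_orthGain hn hlam)

theorem indepFun_orthGain_leakage (hn : 0 < n) (hlam : 0 < lam) :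
    IndepFun M.orthGain M.leakage μ := by
  have hindep : IndepFun (fun ω => (M.U ω, M.hx ω)) M.orthGain μ :=
    (indepFun_iff_hasLaw_prodMk_prod ⟨by fun_prop, rfl⟩ (M.hasLaw_orthGain hn hlam)).mpr
      (M.hasLaw_prodMk_orthGain hn hlam)
  have hleak : Measurable fun p : 𝒰 × EuclideanSpace ℂ (Fin (n + 1)) =>
      ‖p.2‖ ^ 2 / lam * (quantError (M.Q (shape p.2) p.1) (shape p.2) / decay n B) := by
    fun_prop
  exact (hindep.comp hleak measurable_id).symm

theorem hasLaw_gp_orthGain_leakage (hn : 0 < n) (hlam : 0 < lam) :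
    HasLaw (fun ω => (M.gp ω, M.orthGain ω, M.leakage ω))
      ((expMeasure 1).prod ((gammaMeasure n 1).prod (gammaMeasure n 1))) μ :=
  M.indepFun_gp_orthGain_leakage.hasLaw_prod ⟨by fun_prop, M.law_gp⟩
    ((M.indepFun_orthGain_leakage hn hlam).hasLaw_prod (M.hasLaw_orthGain hn hlam)
      (M.hasLaw_leakage hn hlam))

end SystemModel

section LimitingOutage

theorem expMeasure_real_Icc {s t : ℝ} (hs : 0 ≤ s) (hst : s ≤ t) :
    (expMeasure 1).real (Set.Icc s t) = Real.exp (-s) - Real.exp (-t) := by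
  have := isProbabilityMeasure_expMeasure one_pos
  have : NullSingletonClass (expMeasure 1) := by
    unfold expMeasure gammaMeasure
    infer_instance
  have hIic {x : ℝ} (hx : 0 ≤ x) : (expMeasure 1).real (Set.Iic x) = 1 - Real.exp (-x) := by
    rw [← cdf_eq_real, cdf_expMeasure_eq one_pos, if_pos hx, one_mul]
  rw [measureReal_congr Ioc_ae_eq_Icc.symm, ← Set.Iic_sdiff_Iic,
    measureReal_sdiff (Set.Iic_subset_Iic.mpr hst) measurableSet_Iic, hIic hs,
    hIic (hs.trans hst)]
  ring

/-- The outage event in the limit of unbounded maximal power, as a set of triples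
`(gₚ, orthogonal gain, normalized leakage)`. The parameter `a` is `θₚ / γₚ`, and `κ` is
`λ θₛ decay n B`. -/
def limitOutageSet (a κ : ℝ) : Set (ℝ × ℝ × ℝ) :=
  {p | 0 ≤ p.1 / a - 1 ∧ p.2.1 * (p.1 / a - 1) ≤ κ * p.2.2}

theorem measurableSet_limitOutageSet (a κ : ℝ) : MeasurableSet (limitOutageSet a κ) := by
  unfold limitOutageSet
  measurability

theorem expMeasure_real_limitOutageSet_slice {a κ g w : ℝ} (ha : 0 < a) (hκ : 0 ≤ κ) (hg : 0 < g)
    (hw : 0 ≤ w) :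
    (expMeasure 1).real ((fun x => (x, g, w)) ⁻¹' limitOutageSet a κ) =
      Real.exp (-a) * (1 - Real.exp (-(a * κ / g) * w)) := by
  have hslice : (fun x => (x, g, w)) ⁻¹' limitOutageSet a κ = Set.Icc a (a + a * κ / g * w) := by
    ext x
    simp only [limitOutageSet, Set.mem_preimage, Set.mem_ofPred_eq, Set.mem_Icc, sub_nonneg,
      one_le_div ha]
    refine and_congr_right fun _ => ?_
    rw [← le_div_iff₀' hg, sub_le_iff_le_add, div_le_iff₀ ha]
    ring_nf
  rw [hslice, expMeasure_real_Icc ha.le (le_add_of_nonneg_right (by positivity)), neg_add,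
    Real.exp_add, neg_mul]
  ring

/-- The mean of `1 - (1 + t / G)⁻ⁿ` for a `Gamma(n)` variable `G`: the probability of outage, in
the limit of unbounded maximal power, given that the interference margin is nonnegative. -/
noncomputable def outageProfile (n : ℕ) (t : ℝ) : ℝ :=
  ∫ g, (1 - (1 + t / g) ^ (-n : ℝ)) ∂(gammaMeasure n 1)

theorem prod_real_limitOutageSet {n : ℕ} (hn : 0 < n) {a κ : ℝ} (ha : 0 < a) (hκ : 0 ≤ κ) :
    ((expMeasure 1).prod ((gammaMeasure n 1).prod (gammaMeasure n 1))).real (limitOutageSet a κ) =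
      Real.exp (-a) * outageProfile n (a * κ) := by
  have := isProbabilityMeasure_expMeasure one_pos
  have hn' : (0 : ℝ) < n := by exact_mod_cast hn
  have := isProbabilityMeasure_gammaMeasure hn' one_pos
  have hmeas := measurable_measure_prodMk_right (μ := expMeasure 1)
    (measurableSet_limitOutageSet a κ)
  have hint : Integrable (fun p => (expMeasure 1).real ((fun x => (x, p)) ⁻¹' limitOutageSet a κ))
      ((gammaMeasure n 1).prod (gammaMeasure n 1)) :=
    Integrable.of_bound hmeas.ennreal_toReal.aestronglyMeasurable 1
      (ae_of_all _ fun p => by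
      rw [Real.norm_of_nonneg measureReal_nonneg]
      exact measureReal_le_one)
  rw [measureReal_def, Measure.prod_apply_symm (measurableSet_limitOutageSet a κ),
    ← integral_toReal hmeas.aemeasurable (ae_of_all _ fun _ => measure_lt_top _ _)]
  simp_rw [← measureReal_def]
  rw [integral_prod _ hint, outageProfile, ← integral_const_mul]
  refine integral_congr_ae ((ae_pos_gammaMeasure n 1).mono fun g hg => ?_)
  have ht : -(a * κ / g) < 1 := by
    have : 0 ≤ a * κ / g := by positivity
    linarith
  have hexp : Integrable (fun w => Real.exp (-(a * κ / g) * w)) (gammaMeasure n 1) :=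
    Iio_subset_integrableExpSet_gammaMeasure hn' one_pos ht
  calc ∫ w, (expMeasure 1).real ((fun x => (x, g, w)) ⁻¹' limitOutageSet a κ) ∂gammaMeasure n 1
      = ∫ w, Real.exp (-a) * (1 - Real.exp (-(a * κ / g) * w)) ∂gammaMeasure n 1 :=
        integral_congr_ae ((ae_pos_gammaMeasure n 1).mono fun w hw =>
          expMeasure_real_limitOutageSet_slice ha hκ hg hw.le)
    _ = Real.exp (-a) * (1 - mgf id (gammaMeasure n 1) (-(a * κ / g))) := by
        rw [integral_const_mul, integral_sub (integrable_const _) hexp]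
        simp [mgf]
    _ = Real.exp (-a) * (1 - (1 + a * κ / g) ^ (-n : ℝ)) := by
        rw [mgf_id_gammaMeasure hn' one_pos ht]
        simp

end LimitingOutage

namespace SystemModel

variable {Ω 𝒰 : Type*} [MeasurableSpace Ω] [MeasurableSpace 𝒰] {μ : Measure Ω} {n : ℕ} {lam : ℝ}
  {B : ℕ} (M : SystemModel (𝒰 := 𝒰) μ (n + 1) lam B) {σ2 γp θp θs Pmax : ℝ}

theorem measurable_suPower : Measurable (M.suPower σ2 γp θp Pmax) := by
  have hmargin : Measurable fun ω => interferenceMargin σ2 γp θp (M.gp ω) := by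
    unfold interferenceMargin
    fun_prop
  have hnonneg := measurableSet_le (measurable_const (a := (0 : ℝ))) hmargin
  have hsignal : Measurable fun ω => ipcSignal lam Pmax (interferenceMargin σ2 γp θp (M.gp ω))
      (M.gx ω) (quantError (M.sxHat ω) (shape (M.hx ω))) := by
    unfold ipcSignal
    exact Measurable.ite hnonneg (by fun_prop) measurable_const
  unfold suPower powerBudget
  exact Measurable.ite (hnonneg.inter (measurableSet_lt hsignal measurable_const)) hsignal
    measurable_const

theorem suPower_nonneg (hlam : 0 < lam) (hP : 0 ≤ Pmax) {ω : Ω} (hx : M.hx ω ≠ 0) :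
    0 ≤ M.suPower σ2 γp θp Pmax ω := by
  have hq : 0 ≤ quantError (M.sxHat ω) (shape (M.hx ω)) :=
    quantError_nonneg (M.norm_Q _ _ (norm_shape hx)) (norm_shape hx)
  have hg : 0 ≤ M.gx ω := by unfold gx; positivity
  unfold suPower powerBudget
  split_ifs with h
  · rw [ipcSignal, if_pos h.1]
    exact div_nonneg h.1 (by positivity)
  · exact hP

theorem snr_eq (hlam : 0 < lam) (hP : 0 ≤ Pmax) {f : Ω → EuclideanSpace ℂ (Fin (n + 1))} {ω : Ω}
    (hx : M.hx ω ≠ 0)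
    (hf : IsOCB (M.sxHat ω) (shape (M.hs ω)) (M.suPower σ2 γp θp Pmax ω) (f ω)) :
    M.snr σ2 f ω = M.orthGain ω / σ2 * M.suPower σ2 γp θp Pmax ω := by
  rw [snr, hf.norm_inner_sq (M.norm_Q _ _ (norm_shape hx)) (M.suPower_nonneg hlam hP hx), orthGain,
    ← norm_sq_mul_norm_shape_sq_sub (M.sxHat ω), sxHat]
  ring

theorem eventually_outage_iff (hσ : 0 < σ2) (hlam : 0 < lam) (hθ : 0 < θp) {ω : Ω}
    (hW : 0 < M.leakage ω) (hG : 0 < M.orthGain ω) :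
    ∀ᶠ Pmax : ℝ in atTop, M.orthGain ω / σ2 * M.suPower σ2 γp θp Pmax ω ≤ θs ↔
      (M.gp ω, M.orthGain ω, M.leakage ω) ∈ limitOutageSet (θp / γp) (lam * θs * decay n B) := by
  have hδ := decay_pos n B
  have hleak : lam * M.gx ω * quantError (M.sxHat ω) (shape (M.hx ω)) =
      lam * (decay n B * M.leakage ω) := by
    rw [leakage]
    field_simp
  have hmargin : interferenceMargin σ2 γp θp (M.gp ω) = σ2 * (M.gp ω / (θp / γp) - 1) := by
    rw [interferenceMargin]
    field_simp
  simp only [suPower, powerBudget, ipcSignal, hleak, hmargin, limitOutageSet, Set.mem_ofPred_eq]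
  generalize M.gp ω / (θp / γp) - 1 = w
  generalize M.orthGain ω = G at hG
  generalize M.leakage ω = W at hW
  rcases le_or_gt 0 w with hw | hw
  · filter_upwards [eventually_gt_atTop (σ2 * w / (lam * (decay n B * W)))] with Pmax hP
    simp only [hw, mul_nonneg hσ.le hw, hP, if_true, and_self, true_and]
    have hcancel : G / σ2 * (σ2 * w / (lam * (decay n B * W))) =
        G * w / (lam * (decay n B * W)) := by field_simp
    rw [hcancel, div_le_iff₀ (by positivity)]
    ring_nf
  · filter_upwards [eventually_gt_atTop (θs / (G / σ2))] with Pmax hP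
    simp only [hw.not_ge, (mul_neg_of_pos_of_neg hσ hw).not_ge, false_and, if_false, iff_false,
      not_le]
    rwa [div_lt_iff₀' (by positivity)] at hP

variable [IsProbabilityMeasure μ]

theorem tendsto_outage (hn : 0 < n) (hlam : 0 < lam) (hσ : 0 < σ2) (hγ : 0 < γp) (hθp : 0 < θp)
    (hθs : 0 ≤ θs) {f : ℝ → Ω → EuclideanSpace ℂ (Fin (n + 1))}
    (hf : ∀ Pmax : ℝ, 0 < Pmax → M.IsBeamformer σ2 γp θp Pmax (f Pmax)) :
    Tendsto (fun Pmax : ℝ => M.outage σ2 θs (f Pmax)) atTop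
      (𝓝 (Real.exp (-(θp / γp)) * outageProfile n (θp / γp * (lam * θs * decay n B)))) := by
  have hδ := decay_pos n B
  have hlaw := M.hasLaw_gp_orthGain_leakage hn hlam
  have hmeas := measurableSet_limitOutageSet (θp / γp) (lam * θs * decay n B)
  have hpos {X : Ω → ℝ} (hX : HasLaw X (gammaMeasure n 1) μ) : ∀ᵐ ω ∂μ, 0 < X ω :=
    ae_of_ae_map hX.aemeasurable (hX.map_eq ▸ ae_pos_gammaMeasure n 1)
  have hlim : Tendsto
      (fun Pmax => μ.real {ω | M.orthGain ω / σ2 * M.suPower σ2 γp θp Pmax ω ≤ θs}) atTop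
      (𝓝 (μ.real {ω | (M.gp ω, M.orthGain ω, M.leakage ω) ∈
        limitOutageSet (θp / γp) (lam * θs * decay n B)})) := by
    refine (ENNReal.tendsto_toReal (measure_ne_top μ _)).comp
      (tendsto_measure_of_ae_tendsto_indicator_of_isFiniteMeasure atTop ?_ (fun Pmax => ?_) ?_)
    · exact (show Measurable fun ω => (M.gp ω, M.orthGain ω, M.leakage ω) by fun_prop) hmeas
    · exact measurableSet_le ((M.measurable_orthGain.div_const _).mul M.measurable_suPower)
        measurable_const
    · filter_upwards [hpos (M.hasLaw_leakage hn hlam), hpos (M.hasLaw_orthGain hn hlam)]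
        with ω hW hG
      exact M.eventually_outage_iff hσ hlam hθp hW hG
  rw [hlaw.measureReal_eq (p := (· ∈ limitOutageSet (θp / γp) (lam * θs * decay n B))) hmeas,
    Set.ofPred_mem_eq, prod_real_limitOutageSet hn (by positivity) (by positivity)] at hlim
  refine hlim.congr' ?_
  filter_upwards [eventually_gt_atTop 0] with Pmax hP
  refine measureReal_congr ?_
  filter_upwards [hf Pmax hP, M.ae_hx_ne_zero hlam] with ω hω hx
  exact congrArg (· ≤ θs) (M.snr_eq hlam hP.le hx hω).symm

end SystemModel

section OutageProfile

theorem one_sub_inv_one_add_pow_le (n : ℕ) {y : ℝ} (hy : 0 ≤ y) :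
    1 - ((1 + y) ^ n)⁻¹ ≤ n * (y / (1 + y)) := by
  have h := one_add_mul_le_pow (a := -(y / (1 + y)))
    (by linarith [div_le_one_of_le₀ (by linarith : y ≤ 1 + y) (by positivity)]) n
  rw [show 1 + -(y / (1 + y)) = (1 + y)⁻¹ by field_simp; ring, inv_pow] at h
  linarith

theorem mul_sub_one_sub_inv_one_add_pow_le (n : ℕ) {y : ℝ} (hy : 0 ≤ y) :
    n * y - (1 - ((1 + y) ^ n)⁻¹) ≤ n * (n + 1) / 2 * (y ^ 2 / (1 + y)) := by
  induction n with
  | zero => simp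
  | succ n ih =>
    have hstep : y - (((1 + y) ^ n)⁻¹ - ((1 + y) ^ (n + 1))⁻¹) =
        y * (1 - ((1 + y) ^ (n + 1))⁻¹) := by
      field_simp
      ring
    have hbernoulli := mul_le_mul_of_nonneg_left (one_sub_inv_one_add_pow_le (n + 1) hy) hy
    have hsq : y * ((n + 1 : ℕ) * (y / (1 + y))) = (n + 1) * (y ^ 2 / (1 + y)) := by
      push_cast
      ring
    push_cast
    linarith

theorem abs_one_sub_inv_one_add_pow_sub_le (n : ℕ) {y : ℝ} (hy : 0 ≤ y) :
    |1 - ((1 + y) ^ n)⁻¹ - n * y| ≤ n * (n + 1) / 2 * (y ^ 2 / (1 + y)) := by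
  have hself : n * (y / (1 + y)) ≤ n * y := by
    gcongr
    exact div_le_self hy (by linarith)
  rw [abs_of_nonpos (by linarith [one_sub_inv_one_add_pow_le n hy])]
  linarith [mul_sub_one_sub_inv_one_add_pow_le n hy]

theorem integral_inv_gammaMeasure {a r : ℝ} (ha : 1 < a) (hr : 0 < r) :
    ∫ x, x⁻¹ ∂(gammaMeasure a r) = r / (a - 1) := by
  have ha1 : 0 < a - 1 := sub_pos.mpr ha
  simp_rw [← Real.rpow_neg_one]
  rw [integral_rpow_gammaMeasure (by linarith) hr (by linarith), Real.rpow_neg_one,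
    ← sub_eq_add_neg, ← sub_add_cancel a 1, Real.Gamma_add_one ha1.ne', sub_add_cancel]
  have := Real.Gamma_pos_of_pos ha1
  field_simp

theorem integrable_inv_gammaMeasure {a r : ℝ} (ha : 1 < a) (hr : 0 < r) :
    Integrable (fun x => x⁻¹) (gammaMeasure a r) := by
  simpa only [Real.rpow_neg_one] using
    integrable_rpow_gammaMeasure (s := -1) (by linarith) hr (by linarith)

theorem integrable_inv_mul_add_gammaMeasure {a r t : ℝ} (ha : 1 < a) (hr : 0 < r) (ht : 0 < t) :
    Integrable (fun x => (x * (x + t))⁻¹) (gammaMeasure a r) := by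
  refine ((integrable_inv_gammaMeasure ha hr).mul_const t⁻¹).mono' (by fun_prop) ?_
  filter_upwards [ae_pos_gammaMeasure a r] with x hx
  rw [Real.norm_of_nonneg (by positivity), ← mul_inv]
  gcongr
  linarith

theorem abs_outageProfile_sub_le {n : ℕ} (hn : 2 ≤ n) {t : ℝ} (ht : 0 < t) :
    |outageProfile n t - n / (n - 1) * t| ≤
      n * (n + 1) / 2 * (t ^ 2 * ∫ g, (g * (g + t))⁻¹ ∂(gammaMeasure n 1)) := by
  have hn1 : (1 : ℝ) < n := by exact_mod_cast hn
  have := isProbabilityMeasure_gammaMeasure (zero_lt_one.trans hn1) one_pos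
  have hrpow {g : ℝ} (hg : 0 < g) : (1 + t / g) ^ (-n : ℝ) = ((1 + t / g) ^ n)⁻¹ := by
    rw [Real.rpow_neg (by positivity), Real.rpow_natCast]
  have hprofile : Integrable (fun g => 1 - (1 + t / g) ^ (-n : ℝ)) (gammaMeasure n 1) := by
    refine Integrable.of_bound (by measurability) 1 ?_
    filter_upwards [ae_pos_gammaMeasure n 1] with g hg
    have hone : 1 ≤ 1 + t / g := le_add_of_nonneg_right (by positivity)
    have hle : ((1 + t / g) ^ n)⁻¹ ≤ 1 := inv_le_one_of_one_le₀ (one_le_pow₀ hone)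
    rw [hrpow hg, Real.norm_of_nonneg (by linarith)]
    exact sub_le_self _ (by positivity)
  have hlinear : Integrable (fun g => n * t * g⁻¹) (gammaMeasure n 1) :=
    (integrable_inv_gammaMeasure hn1 one_pos).const_mul _
  have hmean : n / (n - 1) * t = ∫ g, n * t * g⁻¹ ∂(gammaMeasure n 1) := by
    rw [integral_const_mul, integral_inv_gammaMeasure hn1 one_pos]
    ring
  rw [outageProfile, hmean, ← integral_sub hprofile hlinear, ← integral_const_mul,
    ← integral_const_mul, ← Real.norm_eq_abs]
  refine norm_integral_le_of_norm_le
    (((integrable_inv_mul_add_gammaMeasure hn1 one_pos ht).const_mul _).const_mul _) ?_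
  filter_upwards [ae_pos_gammaMeasure n 1] with g hg
  have hlin : n * t * g⁻¹ = n * (t / g) := by ring
  have hquad : t ^ 2 * (g * (g + t))⁻¹ = (t / g) ^ 2 / (1 + t / g) := by field_simp
  rw [hrpow hg, hlin, hquad, Real.norm_eq_abs]
  exact abs_one_sub_inv_one_add_pow_sub_le n (by positivity)

theorem outageProfile_sub_isBigO {n : ℕ} (hn : 3 ≤ n) :
    (fun t => outageProfile n t - n / (n - 1) * t) =O[𝓝[>] 0] fun t => t ^ 2 := by
  have hn' : (3 : ℝ) ≤ n := by exact_mod_cast hn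
  refine IsBigO.of_bound (n * (n + 1) / 2 * ∫ g, g ^ (-2 : ℝ) ∂(gammaMeasure n 1)) ?_
  filter_upwards [self_mem_nhdsWithin] with t (ht : 0 < t)
  have hle : ∫ g, (g * (g + t))⁻¹ ∂(gammaMeasure n 1) ≤ ∫ g, g ^ (-2 : ℝ) ∂(gammaMeasure n 1) := by
    refine integral_mono_ae (integrable_inv_mul_add_gammaMeasure (by linarith) one_pos ht)
      (integrable_rpow_gammaMeasure (by linarith) one_pos (by linarith)) ?_
    filter_upwards [ae_pos_gammaMeasure n 1] with g hg
    rw [Real.rpow_neg hg.le, Real.rpow_two, sq]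
    gcongr
    linarith
  rw [Real.norm_eq_abs, Real.norm_of_nonneg (by positivity)]
  calc |outageProfile n t - n / (n - 1) * t|
      ≤ n * (n + 1) / 2 * (t ^ 2 * ∫ g, (g * (g + t))⁻¹ ∂(gammaMeasure n 1)) :=
        abs_outageProfile_sub_le (by omega) ht
    _ ≤ n * (n + 1) / 2 * (t ^ 2 * ∫ g, g ^ (-2 : ℝ) ∂(gammaMeasure n 1)) := by gcongr
    _ = _ := by ring

theorem intervalIntegral_inv_add {t : ℝ} (ht : 0 < t) :
    ∫ x in (0 : ℝ)..1, (x + t)⁻¹ = Real.log (1 + t) - Real.log t := by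
  rw [intervalIntegral.integral_comp_add_right (fun x => x⁻¹), zero_add,
    integral_inv_of_pos ht (by linarith), Real.log_div (by linarith) ht.ne']

theorem integral_inv_mul_add_gammaMeasure_two (t : ℝ) :
    ∫ g, (g * (g + t))⁻¹ ∂(gammaMeasure 2 1) =
      ∫ x in Set.Ioi (0 : ℝ), Real.exp (-x) * (x + t)⁻¹ := by
  rw [integral_gammaMeasure two_pos one_pos, Real.one_rpow, Real.Gamma_two, div_one, one_smul]
  refine setIntegral_congr_fun measurableSet_Ioi fun x (hx : 0 < x) => ?_
  rw [show (2 : ℝ) - 1 = 1 by norm_num, Real.rpow_one, one_mul, smul_eq_mul, mul_inv]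
  field_simp

theorem exp_neg_mul_inv_add_le {x t : ℝ} (hx : 0 < x) (ht : 0 < t) :
    Real.exp (-x) * (x + t)⁻¹ ≤
      Real.exp (-x) + (Set.Ioc 0 1).indicator (fun x => (x + t)⁻¹) x := by
  rcases le_or_gt x 1 with hx1 | hx1
  · rw [Set.indicator_of_mem (Set.mem_Ioc.mpr ⟨hx, hx1⟩)]
    have : Real.exp (-x) * (x + t)⁻¹ ≤ (x + t)⁻¹ :=
      mul_le_of_le_one_left (by positivity) (Real.exp_le_one_iff.mpr (by linarith))
    linarith [Real.exp_pos (-x)]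
  · rw [Set.indicator_of_notMem fun h => hx1.not_ge h.2, add_zero]
    exact mul_le_of_le_one_right (Real.exp_pos _).le (inv_le_one_of_one_le₀ (by linarith))

theorem integral_inv_mul_add_gammaMeasure_two_le {t : ℝ} (ht : 0 < t) :
    ∫ g, (g * (g + t))⁻¹ ∂(gammaMeasure 2 1) ≤ 1 + (Real.log (1 + t) - Real.log t) := by
  have hexp : IntegrableOn (fun x : ℝ => Real.exp (-x)) (Set.Ioi 0) := integrableOn_exp_neg_Ioi 0
  have hinv : IntegrableOn (fun x : ℝ => (x + t)⁻¹) (Set.Ioc 0 1) := by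
    refine (ContinuousOn.integrableOn_Icc fun x hx => ?_).mono_set Set.Ioc_subset_Icc_self
    exact ContinuousAt.continuousWithinAt
      (ContinuousAt.inv₀ (by fun_prop) (by linarith [hx.1]))
  have hind : IntegrableOn ((Set.Ioc 0 1).indicator fun x : ℝ => (x + t)⁻¹) (Set.Ioi 0) :=
    ((integrable_indicator_iff measurableSet_Ioc).mpr hinv).integrableOn
  calc ∫ g, (g * (g + t))⁻¹ ∂(gammaMeasure 2 1)
      = ∫ x in Set.Ioi (0 : ℝ), Real.exp (-x) * (x + t)⁻¹ :=
        integral_inv_mul_add_gammaMeasure_two t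
    _ ≤ ∫ x in Set.Ioi (0 : ℝ),
          (Real.exp (-x) + (Set.Ioc 0 1).indicator (fun x => (x + t)⁻¹) x) := by
        refine integral_mono_of_nonneg ?_ (hexp.add hind) ?_ <;>
          filter_upwards [ae_restrict_mem measurableSet_Ioi] with x (hx : 0 < x)
        · dsimp only [Pi.zero_apply]
          positivity
        · exact exp_neg_mul_inv_add_le hx ht
    _ = 1 + (Real.log (1 + t) - Real.log t) := by
        rw [integral_add hexp hind, integral_exp_neg_Ioi_zero,
          setIntegral_indicator measurableSet_Ioc,
          Set.inter_eq_right.mpr Set.Ioc_subset_Ioi_self,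
          ← intervalIntegral.integral_of_le zero_le_one, intervalIntegral_inv_add ht]

theorem outageProfile_two_sub_isBigO :
    (fun t => outageProfile 2 t - 2 * t) =O[𝓝[>] 0] fun t => t ^ 2 * Real.log t := by
  refine IsBigO.of_bound 9 ?_
  filter_upwards [self_mem_nhdsWithin, mem_nhdsWithin_of_mem_nhds (Iio_mem_nhds one_pos),
    Real.tendsto_log_nhdsGT_zero.eventually_le_atBot (-1)] with t (ht : 0 < t) (ht1 : t < 1) hlog
  have hint : ∫ g, (g * (g + t))⁻¹ ∂(gammaMeasure 2 1) ≤ 3 * -Real.log t := by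
    have := integral_inv_mul_add_gammaMeasure_two_le ht
    have := Real.log_le_sub_one_of_pos (by linarith : 0 < 1 + t)
    linarith
  have h := abs_outageProfile_sub_le le_rfl ht
  rw [Nat.cast_ofNat, show (2 : ℝ) / (2 - 1) = 2 by norm_num] at h
  rw [norm_mul, Real.norm_eq_abs, Real.norm_of_nonneg (sq_nonneg t),
    Real.norm_of_nonpos (by linarith)]
  calc |outageProfile 2 t - 2 * t|
      ≤ 2 * (2 + 1) / 2 * (t ^ 2 * ∫ g, (g * (g + t))⁻¹ ∂(gammaMeasure 2 1)) := h
    _ ≤ 2 * (2 + 1) / 2 * (t ^ 2 * (3 * -Real.log t)) := by gcongr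
    _ = _ := by ring

theorem inv_mul_add_le_rpow {g t : ℝ} (hg : 0 < g) (ht : 0 < t) :
    (g * (g + t))⁻¹ ≤ g ^ (-(3 / 2) : ℝ) * (2 * √t)⁻¹ := by
  have hrpow : g ^ (3 / 2 : ℝ) = g * √g := by
    rw [Real.sqrt_eq_rpow, ← Real.rpow_one_add' hg.le (by norm_num)]
    norm_num
  have hamgm : 2 * √g * √t ≤ g + t := by
    have := two_mul_le_add_sq √g √t
    rwa [Real.sq_sqrt hg.le, Real.sq_sqrt ht.le] at this
  rw [Real.rpow_neg hg.le, hrpow, ← mul_inv]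
  gcongr ?_⁻¹
  calc g * √g * (2 * √t) = g * (2 * √g * √t) := by ring
    _ ≤ g * (g + t) := by gcongr

theorem exists_mul_sub_mul_sq_le_outageProfile {n : ℕ} (hn : 2 ≤ n) :
    ∃ q > 1, ∃ C, ∀ t > 0, q * t - C * t ^ 2 ≤ outageProfile n t := by
  have hn' : (2 : ℝ) ≤ n := by exact_mod_cast hn
  set η : ℝ := (2 * (n - 1))⁻¹
  set K : ℝ := n * (n + 1) / 4 * ∫ g, g ^ (-(3 / 2) : ℝ) ∂(gammaMeasure n 1)
  have hη : 0 < η := inv_pos.mpr (by linarith)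
  refine ⟨1 + η, by linarith, K ^ 2 / (4 * η), fun t ht => ?_⟩
  have hint : ∫ g, (g * (g + t))⁻¹ ∂(gammaMeasure n 1) ≤
      (∫ g, g ^ (-(3 / 2) : ℝ) ∂(gammaMeasure n 1)) * (2 * √t)⁻¹ := by
    rw [← integral_mul_const]
    refine integral_mono_ae (integrable_inv_mul_add_gammaMeasure (by linarith) one_pos ht)
      ((integrable_rpow_gammaMeasure (by linarith) one_pos (by linarith)).mul_const _) ?_
    exact (ae_pos_gammaMeasure n 1).mono fun g hg => inv_mul_add_le_rpow hg ht
  have herr : |outageProfile n t - n / (n - 1) * t| ≤ t * (K * √t) :=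
    calc |outageProfile n t - n / (n - 1) * t|
        ≤ n * (n + 1) / 2 * (t ^ 2 * ∫ g, (g * (g + t))⁻¹ ∂(gammaMeasure n 1)) :=
          abs_outageProfile_sub_le hn ht
      _ ≤ n * (n + 1) / 2 * (t ^ 2 *
            ((∫ g, g ^ (-(3 / 2) : ℝ) ∂(gammaMeasure n 1)) * (2 * √t)⁻¹)) := by gcongr
      _ = t * (K * (t / √t)) := by ring
      _ = t * (K * √t) := by rw [Real.div_sqrt]
  have hamgm : K * √t ≤ η + K ^ 2 / (4 * η) * t := by
    have := two_mul_le_add_sq (2 * η) (K * √t)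
    rw [mul_pow K, Real.sq_sqrt ht.le] at this
    rw [div_mul_eq_mul_div, ← sub_le_iff_le_add', le_div_iff₀ (by positivity)]
    linarith
  have hslope : n / (n - 1) = 1 + η + η := by
    have : (n : ℝ) - 1 ≠ 0 := by linarith
    simp only [η]
    field_simp
    ring
  have := mul_le_mul_of_nonneg_left hamgm ht.le
  rw [hslope] at herr
  linarith [(abs_le.mp herr).1]

theorem eventually_lt_outageProfile {n : ℕ} (hn : 2 ≤ n) :
    ∀ᶠ t in 𝓝[>] 0, t < outageProfile n t := by
  obtain ⟨q, hq, C, hle⟩ := exists_mul_sub_mul_sq_le_outageProfile hn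
  have hC : Tendsto (fun t => C * t) (𝓝[>] 0) (𝓝 0) :=
    ((continuous_const_mul C).tendsto' 0 0 (mul_zero C)).mono_left nhdsWithin_le_nhds
  filter_upwards [self_mem_nhdsWithin, hC.eventually_lt_const (sub_pos.mpr hq)]
    with t (ht : 0 < t) hCt
  have := mul_pos ht (sub_pos.mpr hCt)
  linarith [hle t ht]

end OutageProfile

section Decay

variable {n : ℕ}

theorem decay_eq_pow (B : ℕ) : decay n B = ((2 : ℝ) ^ (-(n : ℝ)⁻¹)) ^ B := by
  rw [decay, ← Real.rpow_natCast, ← Real.rpow_mul two_pos.le]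
  ring_nf

theorem two_rpow_neg_two_mul_div (B : ℕ) :
    (2 : ℝ) ^ (-(2 * (B : ℝ)) / n) = decay n B ^ 2 := by
  rw [decay, ← Real.rpow_natCast, ← Real.rpow_mul two_pos.le]
  push_cast
  ring_nf

theorem tendsto_mul_decay (hn : 0 < n) {c : ℝ} (hc : 0 < c) :
    Tendsto (fun B => c * decay n B) atTop (𝓝[>] 0) := by
  have hlt : (2 : ℝ) ^ (-(n : ℝ)⁻¹) < 1 :=
    Real.rpow_lt_one_of_one_lt_of_neg one_lt_two (by simpa using hn)
  refine tendsto_nhdsWithin_of_tendsto_nhds_of_eventually_within _ ?_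
    (Eventually.of_forall fun B => mul_pos hc (decay_pos n B))
  simp_rw [decay_eq_pow]
  simpa using (tendsto_pow_atTop_nhds_zero_of_lt_one (by positivity) hlt).const_mul c

theorem log_mul_decay_isBigO {c : ℝ} (hc : 0 < c) :
    (fun B => Real.log (c * decay n B)) =O[atTop] fun B => (B : ℝ) := by
  have hlog (B : ℕ) : Real.log (c * decay n B) = Real.log c - Real.log 2 / n * B := by
    rw [Real.log_mul hc.ne' (decay_pos n B).ne', decay, Real.log_rpow two_pos]
    ring
  simp_rw [hlog]
  exact ((isLittleO_const_id_atTop _).isBigO.comp_tendsto tendsto_natCast_atTop_atTop).sub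
    ((isBigO_refl _ _).const_mul_left _)

theorem outageProfile_mul_decay_sub_isBigO (hn : 3 ≤ n) {c : ℝ} (hc : 0 < c) :
    (fun B => outageProfile n (c * decay n B) - n / (n - 1) * (c * decay n B))
      =O[atTop] fun B => decay n B ^ 2 := by
  refine ((outageProfile_sub_isBigO hn).comp_tendsto (tendsto_mul_decay (by omega) hc)).trans ?_
  simp only [Function.comp_def, mul_pow]
  exact (isBigO_refl _ _).const_mul_left _

theorem outageProfile_two_mul_decay_sub_isBigO {c : ℝ} (hc : 0 < c) :
    (fun B => outageProfile 2 (c * decay 2 B) - 2 * (c * decay 2 B))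
      =O[atTop] fun B => B * decay 2 B ^ 2 := by
  refine (outageProfile_two_sub_isBigO.comp_tendsto (tendsto_mul_decay two_pos hc)).trans ?_
  simp only [Function.comp_def, mul_pow, mul_comm (Nat.cast _ : ℝ)]
  exact ((isBigO_refl _ _).const_mul_left _).mul (log_mul_decay_isBigO hc)

theorem exists_isBigO_add_lt_outageProfile_mul_decay (hn : 2 ≤ n) {c : ℝ} (hc : 0 < c) :
    ∃ R : ℕ → ℝ, (R =O[atTop] fun B => decay n B ^ 2) ∧
      ∀ B, c * decay n B + R B < outageProfile n (c * decay n B) := by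
  obtain ⟨q, hq, C, hle⟩ := exists_mul_sub_mul_sq_le_outageProfile hn
  refine ⟨fun B => -(C * c ^ 2) * decay n B ^ 2, (isBigO_refl _ _).const_mul_left _, fun B => ?_⟩
  have hpos := mul_pos hc (decay_pos n B)
  have := mul_pos (sub_pos.mpr hq) hpos
  linarith [hle _ hpos, mul_pow c (decay n B) 2]

end Decay

end CognitiveBeamforming

open CognitiveBeamforming in
theorem mainTheorem3_general (L : ℕ) (hL : 3 ≤ L) (lam γp θp θs : ℝ)
    (hlam : 0 < lam) (hγp : 0 < γp) (hθp : 0 < θp) (hθs : 0 < θs) :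
    ∃ Plim : ℕ → ℝ,
      (∀ (B : ℕ) (Ω : Type*) (𝒰 : Type*) [MeasurableSpace Ω] [MeasurableSpace 𝒰]
        (μ : Measure Ω) [IsProbabilityMeasure μ]
        (M : CognitiveBeamforming.SystemModel (𝒰 := 𝒰) μ L lam B)
        (σ2 : ℝ) (_ : 0 < σ2) (f : ℝ → Ω → EuclideanSpace ℂ (Fin L))
        (_ : ∀ Pmax : ℝ, 0 < Pmax → M.IsBeamformer σ2 γp θp Pmax (f Pmax)),
        Tendsto (fun Pmax : ℝ => M.outage σ2 θs (f Pmax)) atTop (𝓝 (Plim B))) ∧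
      (4 ≤ L →
        (fun B : ℕ => Plim B - Real.exp (-(θp / γp)) *
            ((((L : ℝ) - 1) * lam * θp * θs) / (((L : ℝ) - 2) * γp)) *
            (2 : ℝ) ^ (-(B : ℝ) / ((L : ℝ) - 1)))
          =O[atTop] fun B : ℕ => (2 : ℝ) ^ (-(2 * (B : ℝ)) / ((L : ℝ) - 1))) ∧
      (L = 3 →
        (fun B : ℕ => Plim B - Real.exp (-(θp / γp)) *
            ((((L : ℝ) - 1) * lam * θp * θs) / (((L : ℝ) - 2) * γp)) *
            (2 : ℝ) ^ (-(B : ℝ) / ((L : ℝ) - 1)))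
          =O[atTop] fun B : ℕ => (B : ℝ) * (2 : ℝ) ^ (-(2 * (B : ℝ)) / ((L : ℝ) - 1))) ∧
      (∃ R : ℕ → ℝ,
        (R =O[atTop] fun B : ℕ => (2 : ℝ) ^ (-(2 * (B : ℝ)) / ((L : ℝ) - 1))) ∧
        ∀ B : ℕ, Real.exp (-(θp / γp)) * (lam * θp * θs / γp) *
            (2 : ℝ) ^ (-(B : ℝ) / ((L : ℝ) - 1)) + R B < Plim B) ∧
      (∀ᶠ B : ℕ in atTop, Real.exp (-(θp / γp)) * (lam * θp * θs / γp) *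
            (2 : ℝ) ^ (-(B : ℝ) / ((L : ℝ) - 1)) < Plim B) := by
  obtain ⟨n, rfl⟩ : ∃ n, L = n + 1 := ⟨L - 1, by omega⟩
  have hn : 2 ≤ n := by omega
  have hn1 : (n : ℝ) - 1 ≠ 0 := sub_ne_zero.mpr (by norm_cast; omega)
  have hL2 : (n : ℝ) + 1 - 2 = n - 1 := by ring
  have hc : 0 < θp / γp * (lam * θs) := by positivity
  have hmean : n * lam * θp * θs / ((n - 1) * γp) = n / (n - 1) * (θp / γp * (lam * θs)) := by
    field_simp
  have hfloor : lam * θp * θs / γp = θp / γp * (lam * θs) := by ring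
  simp only [hL2, Nat.cast_succ, add_sub_cancel_right, hmean, hfloor, ← decay.eq_1,
    two_rpow_neg_two_mul_div]
  refine ⟨fun B => Real.exp (-(θp / γp)) * outageProfile n (θp / γp * (lam * θs) * decay n B),
    fun B Ω 𝒰 _ _ μ _ M σ2 hσ f hf => ?_, fun h4 => ?_, fun h3 => ?_, ?_, ?_⟩
  · simpa only [mul_assoc] using M.tendsto_outage (by omega) hlam hσ hγp hθp hθs.le hf
  · simpa only [mul_assoc, ← mul_sub] using
      (outageProfile_mul_decay_sub_isBigO (by omega) hc).const_mul_left _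
  · obtain rfl : n = 2 := by omega
    have htwo : ((2 : ℕ) : ℝ) / ((2 : ℕ) - 1) = 2 := by norm_num
    simpa only [htwo, mul_assoc, ← mul_sub] using
      (outageProfile_two_mul_decay_sub_isBigO hc).const_mul_left _
  · obtain ⟨R, hR, hlt⟩ := exists_isBigO_add_lt_outageProfile_mul_decay hn hc
    refine ⟨fun B => Real.exp (-(θp / γp)) * R B, hR.const_mul_left _, fun B => ?_⟩
    simpa only [mul_assoc, ← mul_add] using
      mul_lt_mul_of_pos_left (hlt B) (Real.exp_pos _)
  · filter_upwards [(tendsto_mul_decay (two_pos.trans_le hn) hc).eventually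
      (eventually_lt_outageProfile hn)] with B hB
    simpa only [mul_assoc] using mul_lt_mul_of_pos_left hB (Real.exp_pos _)

theorem mainTheorem3 (L : ℕ) (hL : 3 ≤ L) (lam γp θp θs : ℝ)
    (hlam : 0 < lam) (hlam1 : lam < 1) (hγp : 0 < γp) (hθp : 0 < θp) (hθs : 0 < θs) :
    ∃ Plim : ℕ → ℝ,
      -- for every number of bits `B`, the outage probability tends to `Plim B` as `Pmax → ∞`
      (∀ (B : ℕ) (Ω : Type*) (𝒰 : Type*) [MeasurableSpace Ω] [MeasurableSpace 𝒰]
        (μ : Measure Ω) [IsProbabilityMeasure μ]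
        (M : CognitiveBeamforming.SystemModel (𝒰 := 𝒰) μ L lam B)
        (σ2 : ℝ) (_ : 0 < σ2) (f : ℝ → Ω → EuclideanSpace ℂ (Fin L))
        (_ : ∀ Pmax : ℝ, 0 < Pmax → M.IsBeamformer σ2 γp θp Pmax (f Pmax)),
        Tendsto (fun Pmax : ℝ => M.outage σ2 θs (f Pmax)) atTop (𝓝 (Plim B))) ∧
      -- first-order expansion of the limit
      (4 ≤ L →
        (fun B : ℕ => Plim B - Real.exp (-(θp / γp)) *
            ((((L : ℝ) - 1) * lam * θp * θs) / (((L : ℝ) - 2) * γp)) *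
            (2 : ℝ) ^ (-(B : ℝ) / ((L : ℝ) - 1)))
          =O[atTop] fun B : ℕ => (2 : ℝ) ^ (-(2 * (B : ℝ)) / ((L : ℝ) - 1))) ∧
      (L = 3 →
        (fun B : ℕ => Plim B - Real.exp (-(θp / γp)) *
            ((((L : ℝ) - 1) * lam * θp * θs) / (((L : ℝ) - 2) * γp)) *
            (2 : ℝ) ^ (-(B : ℝ) / ((L : ℝ) - 1)))
          =O[atTop] fun B : ℕ => (B : ℝ) * (2 : ℝ) ^ (-(2 * (B : ℝ)) / ((L : ℝ) - 1))) ∧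
      -- outage floor
      (∃ R : ℕ → ℝ,
        (R =O[atTop] fun B : ℕ => (2 : ℝ) ^ (-(2 * (B : ℝ)) / ((L : ℝ) - 1))) ∧
        ∀ B : ℕ, Real.exp (-(θp / γp)) * (lam * θp * θs / γp) *
            (2 : ℝ) ^ (-(B : ℝ) / ((L : ℝ) - 1)) + R B < Plim B) ∧
      (∀ᶠ B : ℕ in atTop, Real.exp (-(θp / γp)) * (lam * θp * θs / γp) *
            (2 : ℝ) ^ (-(B : ℝ) / ((L : ℝ) - 1)) < Plim B) :=
  mainTheorem3_general L hL lam γp θp θs hlam hγp hθp hθs
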